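/- For $n \ge 1$ let $S_n$ be the group of permutations of $[n]=\{1,\dots,n\}$, and for $2\le i\le n$ let $r_i\in S_n$ be the prefix reversal (pancake flip) with one-line notation $i\,(i-1)\cdots 2\,1\,(i+1)\cdots n$. For $\pi_1,\pi_2\in S_n$ the pancake distance $d(\pi_1,\pi_2)$ is the least $k\ge 0$ such that $\pi_2=\pi_1 r_{i_1}r_{i_2}\cdots r_{i_k}$ for some $i_1,\dots,i_k\in\{2,\dots,n\}$. Let $R_4(n)=|\{\pi\in S_n : d(e,\pi)=4\}|$, where $e$ is the identity permutation. Then for every integer $n\ge 4$, \[ R_4(n)=\frac{1}{2}\left(2n^4-15n^3+29n^2+6n-34\right). \] -/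

import Mathlib

namespace Pancake

/-- The prefix reversal (pancake flip) `r_i` on `n` pancakes, with one-line notation
`i (i-1) ⋯ 2 1 (i+1) ⋯ n`. The set `[n]` is modelled by `Fin n = {0, …, n-1}`, so `r_i` sends
`j < i` to `i - 1 - j` and fixes every `j ≥ i`. -/
def flip {n : ℕ} (i : ℕ) (hi : i ≤ n) : Equiv.Perm (Fin n) :=
  Function.Involutive.toPerm
    (fun j : Fin n => ⟨if (j : ℕ) < i then i - 1 - (j : ℕ) else (j : ℕ), by
      have := j.isLt
      split_ifs <;> omega⟩)
    (by
      intro j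
      apply Fin.ext
      dsimp only
      split_ifs <;> omega)

/-- The set `R = {r_i : 2 ≤ i ≤ n}` of pancake flips. -/
def flips (n : ℕ) : Set (Equiv.Perm (Fin n)) :=
  {r | ∃ (i : ℕ) (hi : i ≤ n), 2 ≤ i ∧ r = flip i hi}

/-- `π₂ = π₁ r_{i₁} ⋯ r_{iₖ}` for some pancake flips `r_{i₁}, …, r_{iₖ}`. -/
def Reaches {n : ℕ} (π₁ π₂ : Equiv.Perm (Fin n)) (k : ℕ) : Prop :=
  ∃ w : List (Equiv.Perm (Fin n)), w.length = k ∧ (∀ r ∈ w, r ∈ flips n) ∧ π₂ = π₁ * w.prod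

/-- The pancake distance between `π₁` and `π₂` is `k`: the least length of a sequence of
pancake flips that leads from `π₁` to `π₂` is `k`. -/
def DistEq {n : ℕ} (π₁ π₂ : Equiv.Perm (Fin n)) (k : ℕ) : Prop :=
  IsLeast {m : ℕ | Reaches π₁ π₂ m} k

/-- `R_k(n)`: the number of permutations in `S_n` at pancake distance exactly `k` from the
identity. -/
noncomputable def numAtDist (k n : ℕ) : ℕ :=
  Set.ncard {π : Equiv.Perm (Fin n) | DistEq 1 π k}

end Pancake

/-! There are (n-1)(n-2)^3 words of four letters in {2, …, n} with distinct neighbours; call them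
reduced. Every permutation at distance four is the value of such a word, so the count amounts to
picking one word per permutation. The words picked are the reduced ones that are not `Reducible`, a
union of explicit linear families; the answer is the number of reduced words minus the number of
reducible ones.

Two facts justify the choice. By `exists_eq_of_reducible`, a reducible word has the value of a word
of four letters with smaller first letter, where the trivial letter 1 is allowed and stands for a
shorter word. Hence at distance four a word with the least possible first letter is not reducible.
Conversely, by `reducible_of_shorter` and `reducible_of_wordMap_eq`, a reduced word with the value
of a shorter word is reducible, and of two distinct reduced words with equal value one is reducible.

The converse needs the relations of length at most eight, that is, the short cycles of the pancake
graph. Rotate a cyclically reduced relation so that it starts with its largest letter m. Smaller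
letters fix the last place m-1, so m occurs at least twice (`not_isRelation_max`); if it occurs
exactly twice, both blocks in between fix the place 0 (`isRelation_max_twice`), which takes at least
three letters each. Thus no relation is shorter than six, and for lengths six, seven and eight few
spacings of m remain. In each of them ρ_m ρ_i ρ_m is the reversal σ_i of a suffix of the first m
places, and following a few places near the two ends determines the letters. -/

namespace Pancake

/-! ### Prefix and suffix reversals as maps on ℕ -/

/-- The prefix reversal of length `a` as a function on `ℕ`. -/
def natFlip (a x : ℕ) : ℕ := if x < a then a - 1 - x else x

theorem natFlip_spec (a x : ℕ) :
    (x < a ∧ natFlip a x + x + 1 = a) ∨ (a ≤ x ∧ natFlip a x = x) := by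
  unfold natFlip; split_ifs <;> omega

theorem natFlip_natFlip (a x : ℕ) : natFlip a (natFlip a x) = x := by
  have := natFlip_spec a x
  have := natFlip_spec a (natFlip a x)
  omega

theorem natFlip_lt {m a x : ℕ} (ha : a ≤ m) (hx : x < m) : natFlip a x < m := by
  have := natFlip_spec a x
  omega

/-- The reversal of the last `i` among the first `m` places. -/
def suffixFlip (m i x : ℕ) : ℕ := natFlip m (natFlip i (natFlip m x))

theorem suffixFlip_spec {m i : ℕ} (h : i ≤ m) (x : ℕ) :
    (m - i ≤ x ∧ x < m ∧ suffixFlip m i x + x + i + 1 = m + m) ∨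
      (x + i < m ∧ suffixFlip m i x = x) ∨ (m ≤ x ∧ suffixFlip m i x = x) := by
  have := natFlip_spec m x
  have := natFlip_spec i (natFlip m x)
  have := natFlip_spec m (natFlip i (natFlip m x))
  unfold suffixFlip; omega

theorem suffixFlip_spec_of_lt {m i x : ℕ} (h : i ≤ m) (hx : x < m) :
    (m ≤ x + i ∧ suffixFlip m i x + x + i + 1 = m + m) ∨ (x + i < m ∧ suffixFlip m i x = x) := by
  have := suffixFlip_spec h x
  omega

theorem natFlip_self_of_add {m x y : ℕ} (h : x + y + 1 = m) : natFlip m x = y := by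
  have := natFlip_spec m x
  omega

local notation "ρ" => natFlip


theorem natFlip_eq_comm {a x y : ℕ} (h : ρ a x = y) : x = ρ a y := by
  rw [← h, natFlip_natFlip]

theorem natFlip_zero {a : ℕ} (h : 0 < a) : ρ a 0 = a - 1 := by
  have := natFlip_spec a 0
  omega

theorem suffixFlip_suffixFlip (m i x : ℕ) : suffixFlip m i (suffixFlip m i x) = x := by
  simp only [suffixFlip, natFlip_natFlip]

theorem suffixFlip_zero {m i : ℕ} (h : i < m) : suffixFlip m i 0 = 0 := by
  have := suffixFlip_spec h.le 0
  omega

theorem suffixFlip_last {m i : ℕ} (h : i ≤ m) (hi : 0 < i) : suffixFlip m i (m - 1) = m - i := by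
  have := suffixFlip_spec h (m - 1)
  omega

theorem suffixFlip_eq_last {m i x : ℕ} (h : i ≤ m) (hi : 0 < i) (hx : suffixFlip m i x = m - 1) :
    x = m - i := by
  rw [← suffixFlip_last h hi, ← hx, suffixFlip_suffixFlip]

theorem natFlip_of_le {a x : ℕ} (h : a ≤ x) : ρ a x = x := by
  have := natFlip_spec a x
  omega

/-! ### Relations sorted by the spacing of their largest letter m -/

/-- Following the first and the last place through a relation `σᵢ f = g ρₘ`. -/
theorem endpoints {m i : ℕ} {f f' g g' : ℕ → ℕ} (hi : 2 ≤ i ∧ i < m)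
    (hff' : ∀ x, f (f' x) = x)  (hgg' : ∀ x, g' (g x) = x)
    (hf' : f' 0 < m)
    (hf : f (m - 1) = m - 1) (hg : g (m - 1) = m - 1)
    (K : ∀ x y, x + y + 1 = m → suffixFlip m i (f x) = g y) :
    m - i = g 0 ∧ f 0 = m - i ∧ f' 0 + g' 0 + 1 = m := by
  refine ⟨?_, ?_, ?_⟩
  · rw [← K (m - 1) 0 (by omega), hf, suffixFlip_last hi.2.le (by omega)]
  · exact suffixFlip_eq_last hi.2.le (by omega) (by rw [K 0 (m - 1) (by omega), hg])
  -- The place that `f` sends to 0 stays at 0 under the suffix reversal, because i < m; so `g` sends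
  -- its mirror image to 0 as well.
  · have h := K (f' 0) (m - 1 - f' 0) (by omega)
    rw [hff', suffixFlip_zero hi.2] at h
    have h' := hgg' (m - 1 - f' 0)
    rw [← h] at h'
    omega

/-- The relation reads σ_i ρ_j = ρ_k ρ_m. The end places give j = k and i + j = m + 1 = 2j; the
place 1 then leaves only m = 3. -/
theorem hexagon_of_three {m i j k : ℕ} (hi : 2 ≤ i ∧ i < m) (hj : 2 ≤ j ∧ j < m)
    (hk : 2 ≤ k ∧ k < m) (H : ∀ x, ρ m (ρ i (ρ m (ρ j (ρ m (ρ k x))))) = x) :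
    m = 3 := by
  have K : ∀ x y, x + y + 1 = m → suffixFlip m i (ρ j x) = ρ k y := by
    intro x y h
    rw [← natFlip_self_of_add h]
    simpa only [suffixFlip, natFlip_natFlip] using H (ρ k (ρ m x))
  have S : ∀ x, x < m → _ := fun x hx ↦ suffixFlip_spec_of_lt hi.2.le (natFlip_lt hj.2.le hx)
  obtain ⟨e₁, e₂, e₃⟩ := endpoints hi (natFlip_natFlip j) (natFlip_natFlip k)
    (natFlip_lt hj.2.le (by omega)) (natFlip_of_le (by omega)) (natFlip_of_le (by omega)) K
  clear H
  rw [natFlip_zero (by omega)] at *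
  have h := K 1 (m - 2) (by omega)
  rcases natFlip_spec j 1 with a | a <;> rcases S 1 (by omega) with b | b <;>
    rcases natFlip_spec k (m - 2) with d | d <;> omega

/-- With three letters m in length seven the gaps are 1, 1, 2, and the relation reads σ_i ρ_j = ρ_q
ρ_p ρ_m. What the end places say depends on the order of p and q; the place 1 decides the rest. -/
theorem heptagon_of_three {m i j p q : ℕ} (hi : 2 ≤ i ∧ i < m) (hj : 2 ≤ j ∧ j < m)
    (hp : 2 ≤ p ∧ p < m) (hq : 2 ≤ q ∧ q < m) (hpq : p ≠ q)
    (H : ∀ x, ρ m (ρ i (ρ m (ρ j (ρ m (ρ p (ρ q x)))))) = x) :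
    (i = 2 ∧ j + 1 = m ∧ p + 1 = m ∧ q + 2 = m) ∨ (i + 1 = m ∧ j = 2 ∧ p + 2 = m ∧ q + 1 = m) := by
  have K : ∀ x y, x + y + 1 = m → suffixFlip m i (ρ j x) = ρ q (ρ p y) := by
    intro x y h
    rw [← natFlip_self_of_add h]
    simpa only [suffixFlip, natFlip_natFlip] using H (ρ q (ρ p (ρ m x)))
  have S : ∀ x, x < m → _ := fun x hx ↦ suffixFlip_spec_of_lt hi.2.le (natFlip_lt hj.2.le hx)
  obtain ⟨e₁, e₂, e₃⟩ := endpoints (g := fun x ↦ ρ q (ρ p x)) (g' := fun x ↦ ρ p (ρ q x)) hi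
    (natFlip_natFlip j) (fun x ↦ by simp only [natFlip_natFlip])
    (natFlip_lt hj.2.le (by omega)) (natFlip_of_le (by omega))
    (by simp only [natFlip_of_le (show p ≤ m - 1 by omega), natFlip_of_le (show q ≤ m - 1 by omega)])
    K
  clear H
  simp only [natFlip_zero (show 0 < p by omega), natFlip_zero (show 0 < q by omega),
    natFlip_zero (show 0 < j by omega)] at e₁ e₂ e₃
  have h := K 1 (m - 2) (by omega)
  rcases lt_or_gt_of_ne hpq with l | l
  · have : ρ q (p - 1) = q - p := natFlip_self_of_add (by omega)
    have : ρ p (q - 1) = q - 1 := natFlip_of_le (by omega)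
    rcases natFlip_spec j 1 with a | a <;> rcases S 1 (by omega) with b | b <;>
      rcases natFlip_spec p (m - 2) with d | d <;> rcases natFlip_spec q (ρ p (m - 2)) with e | e <;>
      omega
  · have : ρ q (p - 1) = p - 1 := natFlip_of_le (by omega)
    have : ρ p (q - 1) = p - q := natFlip_self_of_add (by omega)
    rcases natFlip_spec j 1 with a | a <;> rcases S 1 (by omega) with b | b <;>
      rcases natFlip_spec p (m - 2) with d | d <;> rcases natFlip_spec q (ρ p (m - 2)) with e | e <;>
      omega

/-- The relation reads σ_i ρ_j = ρ_l σ_k, so it comes down to a prefix and a suffix reversal that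
commute. They do when their intervals are disjoint. The exception m = 4, i = j = 3 is the pair of
disjoint transpositions (0 2) and (1 3), whose intervals overlap in fixed or swapped places only.
The images of m-1, 1 and 2 exclude everything else. -/
theorem octagon_of_four {m i j k l : ℕ} (hi : 2 ≤ i ∧ i < m) (hj : 2 ≤ j ∧ j < m)
    (hk : 2 ≤ k ∧ k < m) (hl : 2 ≤ l ∧ l < m)
    (H : ∀ x, ρ m (ρ i (ρ m (ρ j (ρ m (ρ k (ρ m (ρ l x))))))) = x) :
    i = k ∧ j = l ∧ (i + j ≤ m ∨ (m = 4 ∧ i = 3 ∧ j = 3)) := by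
  have K : ∀ x, suffixFlip m i (ρ j x) = ρ l (suffixFlip m k x) := by
    intro x
    simpa only [suffixFlip, natFlip_natFlip] using H (ρ l (suffixFlip m k x))
  have S : ∀ x, x < m → _ := fun x hx ↦ suffixFlip_spec_of_lt hi.2.le (natFlip_lt hj.2.le hx)
  have S' : ∀ x, x < m → _ := fun x hx ↦ suffixFlip_spec_of_lt hk.2.le hx
  clear H
  have h := K (m - 1)
  rcases natFlip_spec j (m - 1) with a | a <;> rcases S (m - 1) (by omega) with b | b <;>
    rcases S' (m - 1) (by omega) with c | c <;>
    rcases natFlip_spec l (suffixFlip m k (m - 1)) with d | d <;> try omega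
  all_goals
    have h := K 1
    rcases natFlip_spec j 1 with a | a <;> rcases S 1 (by omega) with b | b <;>
      rcases S' 1 (by omega) with c | c <;>
      rcases natFlip_spec l (suffixFlip m k 1) with d | d <;> try omega
  all_goals
    have h := K 2
    rcases natFlip_spec j 2 with a | a <;> rcases S 2 (by omega) with b | b <;>
      rcases S' 2 (by omega) with c | c <;>
      rcases natFlip_spec l (suffixFlip m k 2) with d | d <;> try omega


/-- Gaps 1, 2, 2 between the letters m: the relation reads σ_i ρ_j ρ_k = ρ_q ρ_p ρ_m. Each order of
j, k and of p, q turns the end conditions into linear equations; one further place finishes each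
case, and p > q with j < k is impossible. -/
theorem octagon_of_three_spread {m i j k p q : ℕ} (hi : 2 ≤ i ∧ i < m) (hj : 2 ≤ j ∧ j < m)
    (hk : 2 ≤ k ∧ k < m) (hp : 2 ≤ p ∧ p < m) (hq : 2 ≤ q ∧ q < m) (hjk : j ≠ k) (hpq : p ≠ q)
    (H : ∀ x, ρ m (ρ i (ρ m (ρ j (ρ k (ρ m (ρ p (ρ q x))))))) = x) :
    (j + i = m ∧ k = j + 1 ∧ p + 1 = i ∧ q + 1 = m) ∨
      (j + 1 = m ∧ k + 1 = i ∧ p + i = m + 1 ∧ p = q + 1) ∨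
      (i + 1 = m ∧ j = k + 1 ∧ p + k + 1 = m ∧ q = p + 1) := by
  have K : ∀ x y, x + y + 1 = m → suffixFlip m i (ρ j (ρ k x)) = ρ q (ρ p y) := by
    intro x y h
    rw [← natFlip_self_of_add h]
    simpa only [suffixFlip, natFlip_natFlip] using H (ρ q (ρ p (ρ m x)))
  have S : ∀ x, x < m → _ := fun x hx ↦
    suffixFlip_spec_of_lt hi.2.le (natFlip_lt hj.2.le (natFlip_lt hk.2.le hx))
  obtain ⟨e₁, e₂, e₃⟩ := endpoints (f := fun x ↦ ρ j (ρ k x)) (f' := fun x ↦ ρ k (ρ j x))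
    (g := fun x ↦ ρ q (ρ p x)) (g' := fun x ↦ ρ p (ρ q x)) hi
    (fun x ↦ by simp only [natFlip_natFlip]) (fun x ↦ by simp only [natFlip_natFlip])
    (natFlip_lt hk.2.le (natFlip_lt hj.2.le (by omega)))
    (by simp only [natFlip_of_le (show j ≤ m - 1 by omega), natFlip_of_le (show k ≤ m - 1 by omega)])
    (by simp only [natFlip_of_le (show p ≤ m - 1 by omega), natFlip_of_le (show q ≤ m - 1 by omega)])
    K
  clear H
  simp only [natFlip_zero (show 0 < p by omega), natFlip_zero (show 0 < q by omega),
    natFlip_zero (show 0 < j by omega), natFlip_zero (show 0 < k by omega)] at e₁ e₂ e₃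
  rcases lt_or_gt_of_ne hpq with l | l <;> rcases lt_or_gt_of_ne hjk with l' | l'
  · rw [natFlip_self_of_add (show p - 1 + (q - p) + 1 = q by omega)] at e₁
    rw [natFlip_of_le (show p ≤ q - 1 by omega),
      natFlip_self_of_add (show j - 1 + (k - j) + 1 = k by omega)] at e₃
    rw [natFlip_of_le (show j ≤ k - 1 by omega)] at e₂
    left; suffices k = j + 1 by omega
    have h := K 1 (m - 2) (by omega)
    rw [natFlip_of_le (show p ≤ m - 2 by omega)] at h
    have S₁ := S 1 (by omega)
    rw [natFlip_self_of_add (show 1 + (k - 2) + 1 = k by omega)] at h S₁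
    rcases natFlip_spec j (k - 2) with a | a <;> rcases S₁ with b | b <;>
      rcases natFlip_spec q (m - 2) with e | e <;> omega
  · rw [natFlip_self_of_add (show p - 1 + (q - p) + 1 = q by omega)] at e₁
    rw [natFlip_of_le (show p ≤ q - 1 by omega), natFlip_of_le (show k ≤ j - 1 by omega)] at e₃
    rw [natFlip_self_of_add (show k - 1 + (j - k) + 1 = j by omega)] at e₂
    right; right; suffices i + 1 = m by omega
    -- The place j is fixed by both ρ_k and ρ_j, since k < j; only the suffix reversal can move it
    -- on this side.
    have h := K j (m - 1 - j) (by omega)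
    rw [natFlip_of_le l'.le, natFlip_of_le le_rfl] at h
    rcases suffixFlip_spec_of_lt hi.2.le hj.2 with b | b <;>
      rcases natFlip_spec p (m - 1 - j) with d | d <;>
      rcases natFlip_spec q (ρ p (m - 1 - j)) with e | e <;> omega
  · rw [natFlip_of_le (show q ≤ p - 1 by omega)] at e₁
    rw [natFlip_self_of_add (show q - 1 + (p - q) + 1 = p by omega),
      natFlip_self_of_add (show j - 1 + (k - j) + 1 = k by omega)] at e₃
    rw [natFlip_of_le (show j ≤ k - 1 by omega)] at e₂
    exfalso
    have h := K 1 (m - 2) (by omega)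
    have S₁ := S 1 (by omega)
    rw [natFlip_self_of_add (show 1 + (k - 2) + 1 = k by omega)] at h S₁
    rcases natFlip_spec p (m - 2) with d | d <;> rcases natFlip_spec q (ρ p (m - 2)) with e | e <;>
      rcases natFlip_spec j (k - 2) with a | a <;> rcases S₁ with b | b <;> omega
  · rw [natFlip_of_le (show q ≤ p - 1 by omega)] at e₁
    rw [natFlip_self_of_add (show q - 1 + (p - q) + 1 = p by omega),
      natFlip_of_le (show k ≤ j - 1 by omega)] at e₃
    rw [natFlip_self_of_add (show k - 1 + (j - k) + 1 = j by omega)] at e₂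
    right; left; suffices p = q + 1 by omega
    have h := K (m - 2) 1 (by omega)
    rcases natFlip_spec k (m - 2) with c | c <;>
      rcases natFlip_spec j (ρ k (m - 2)) with a | a <;> rcases S (m - 2) (by omega) with b | b <;>
      rcases natFlip_spec p 1 with d | d <;> rcases natFlip_spec q (ρ p 1) with e | e <;>
      omega

/-- Gaps 1, 1, 3: the relation reads σ_i ρ_j = ρ_r ρ_q ρ_p ρ_m. Only the order in which q exceeds
both p and r survives. -/
theorem octagon_of_three_close {m i j p q r : ℕ} (hi : 2 ≤ i ∧ i < m) (hj : 2 ≤ j ∧ j < m)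
    (hp : 2 ≤ p ∧ p < m) (hq : 2 ≤ q ∧ q < m) (hr : 2 ≤ r ∧ r < m) (hpq : p ≠ q) (hqr : q ≠ r)
    (H : ∀ x, ρ m (ρ i (ρ m (ρ j (ρ m (ρ p (ρ q (ρ r x))))))) = x) :
    i + j = m + 1 ∧ p + 1 = i ∧ q + 1 = m ∧ r + 1 = j := by
  have K : ∀ x y, x + y + 1 = m → suffixFlip m i (ρ j x) = ρ r (ρ q (ρ p y)) := by
    intro x y h
    rw [← natFlip_self_of_add h]
    simpa only [suffixFlip, natFlip_natFlip] using H (ρ r (ρ q (ρ p (ρ m x))))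
  have S : ∀ x, x < m → _ := fun x hx ↦
    suffixFlip_spec_of_lt hi.2.le (natFlip_lt hj.2.le hx)
  obtain ⟨e₁, e₂, e₃⟩ := endpoints
    (g := fun x ↦ ρ r (ρ q (ρ p x))) (g' := fun x ↦ ρ p (ρ q (ρ r x))) hi
    (natFlip_natFlip j) (fun x ↦ by simp only [natFlip_natFlip])
    (natFlip_lt hj.2.le (by omega)) (natFlip_of_le (by omega))
    (by simp only [natFlip_of_le (show p ≤ m - 1 by omega), natFlip_of_le (show q ≤ m - 1 by omega),
      natFlip_of_le (show r ≤ m - 1 by omega)]) K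
  clear H
  simp only [natFlip_zero (show 0 < p by omega), natFlip_zero (show 0 < r by omega),
    natFlip_zero (show 0 < j by omega)] at e₁ e₂ e₃
  rcases lt_or_gt_of_ne hpq with l | l <;> rcases lt_or_gt_of_ne hqr with l' | l'
  · rw [natFlip_self_of_add (show p - 1 + (q - p) + 1 = q by omega),
      natFlip_self_of_add (show q - p + (r - 1 - (q - p)) + 1 = r by omega)] at e₁
    rw [natFlip_of_le (show q ≤ r - 1 by omega), natFlip_of_le (show p ≤ r - 1 by omega)] at e₃
    exfalso
    have h := K 1 (m - 2) (by omega)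
    rcases natFlip_spec j 1 with a | a <;> rcases S 1 (by omega) with b | b <;>
      rcases natFlip_spec p (m - 2) with d | d <;> rcases natFlip_spec q (ρ p (m - 2)) with e | e <;>
      rcases natFlip_spec r (ρ q (ρ p (m - 2))) with f | f <;> omega
  · rw [natFlip_self_of_add (show p - 1 + (q - p) + 1 = q by omega)] at e₁
    rw [natFlip_self_of_add (show r - 1 + (q - r) + 1 = q by omega)] at e₃
    have h := K 1 (m - 2) (by omega)
    rcases natFlip_spec r (q - p) with u | u <;> rcases natFlip_spec p (q - r) with v | v <;>
    rcases natFlip_spec j 1 with a | a <;> rcases S 1 (by omega) with b | b <;>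
      rcases natFlip_spec p (m - 2) with d | d <;> rcases natFlip_spec q (ρ p (m - 2)) with e | e <;>
      rcases natFlip_spec r (ρ q (ρ p (m - 2))) with f | f <;> omega
  · rw [natFlip_of_le (show q ≤ p - 1 by omega)] at e₁
    rw [natFlip_of_le (show q ≤ r - 1 by omega)] at e₃
    exfalso
    -- The place p-1 is the one that ρ_p brings to 0, so its image under the three letters is ρ_r
    -- (q-1).
    have h := K (m - p) (p - 1) (by omega)
    have w : ρ p (p - 1) = 0 := natFlip_self_of_add (by omega)
    rw [w, natFlip_zero (by omega)] at h
    rcases natFlip_spec r (p - 1) with u | u <;> rcases natFlip_spec p (r - 1) with v | v <;>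
    rcases natFlip_spec j (m - p) with a | a <;> rcases S (m - p) (by omega) with b | b <;>
      rcases natFlip_spec r (q - 1) with f | f <;> omega
  · rw [natFlip_of_le (show q ≤ p - 1 by omega), natFlip_of_le (show r ≤ p - 1 by omega)] at e₁
    rw [natFlip_self_of_add (show r - 1 + (q - r) + 1 = q by omega),
      natFlip_self_of_add (show q - r + (p - 1 - (q - r)) + 1 = p by omega)] at e₃
    exfalso
    have h := K 1 (m - 2) (by omega)
    rcases natFlip_spec j 1 with a | a <;> rcases S 1 (by omega) with b | b <;>
      rcases natFlip_spec p (m - 2) with d | d <;> rcases natFlip_spec q (ρ p (m - 2)) with e | e <;>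
      rcases natFlip_spec r (ρ q (ρ p (m - 2))) with f | f <;> omega

/-- The letter k sends 0 to k-1 and the letter i sends i-1 to 0, so ρ_j must take k-1 to i-1: either
it fixes that place or it reflects it. -/
theorem three_fix_zero {i j k : ℕ} (hi : 2 ≤ i) (hk : 2 ≤ k)
    (h : ρ i (ρ j (ρ k 0)) = 0) : (k = i ∧ j < k) ∨ i + k = j + 1 := by
  rw [natFlip_zero (by omega)] at h
  have := natFlip_eq_comm h
  rw [natFlip_zero (by omega)] at this
  have := natFlip_spec j (k - 1)
  omega

/-- The word `i (i + k - 1) k` interchanges two adjacent blocks above the place `0`. -/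
theorem blockSwap_spec {i j k : ℕ} (hi : 1 ≤ i) (hk : 1 ≤ k) (h : i + k = j + 1) (x : ℕ) :
    (x = 0 ∧ ρ i (ρ j (ρ k x)) = 0) ∨
      (1 ≤ x ∧ x < k ∧ ρ i (ρ j (ρ k x)) + 1 = x + i) ∨
      (k ≤ x ∧ x < j ∧ ρ i (ρ j (ρ k x)) + k = x + 1) ∨ (j ≤ x ∧ ρ i (ρ j (ρ k x)) = x) := by
  rcases natFlip_spec k x with a | a <;> rcases natFlip_spec j (ρ k x) with b | b <;>
    rcases natFlip_spec i (ρ j (ρ k x)) with c | c <;> omega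

/-- Each block of three letters fixes 0, so by `three_fix_zero` it is a suffix reversal or a swap of
adjacent blocks. The relation says that conjugation by ρ_m carries one block to the inverse of the
other; the four combinations of types give the four alternatives. -/
theorem octagon_of_two {m i j k p q r : ℕ} (hi : 2 ≤ i ∧ i < m) (hj : 2 ≤ j ∧ j < m)
    (hk : 2 ≤ k ∧ k < m) (hp : 2 ≤ p ∧ p < m) (hq : 2 ≤ q ∧ q < m) (hr : 2 ≤ r ∧ r < m)
    (h₁ : ρ i (ρ j (ρ k 0)) = 0) (h₂ : ρ r (ρ q (ρ p 0)) = 0)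
    (H : ∀ x, ρ m (ρ i (ρ j (ρ k (ρ m (ρ p (ρ q (ρ r x))))))) = x) :
    (k = i ∧ j < i ∧ r = p ∧ q = j ∧ p + i = m + j) ∨
      (i + 1 = m ∧ j = 2 ∧ k + 1 = m ∧ p = 2 ∧ q = 3 ∧ r = 2) ∨
      (i = 2 ∧ j = 3 ∧ k = 2 ∧ p + 1 = m ∧ q = 2 ∧ r + 1 = m) ∨
      (j + 1 = m ∧ q + 1 = m ∧ i + k = m ∧ p = i ∧ r = k) := by
  have K : ∀ x y, x + y + 1 = m → ρ i (ρ j (ρ k y)) + ρ r (ρ q (ρ p x)) + 1 = m := by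
    intro x y h
    have e : ρ m (ρ i (ρ j (ρ k y))) = ρ r (ρ q (ρ p x)) := by
      rw [← natFlip_self_of_add h]
      simpa only [natFlip_natFlip] using H (ρ r (ρ q (ρ p x)))
    have l : ρ i (ρ j (ρ k y)) < m :=
      natFlip_lt hi.2.le (natFlip_lt hj.2.le (natFlip_lt hk.2.le (by omega)))
    have := natFlip_spec m (ρ i (ρ j (ρ k y)))
    omega
  clear H
  rcases three_fix_zero hi.1 hk.1 h₁ with ⟨rfl, u⟩ | u <;>
    rcases three_fix_zero hr.1 hp.1 h₂ with ⟨rfl, v⟩ | v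
  · left
    -- Conjugation by ρ_m moves the reversed interval [k-j, k) to [m-k, m-k+j), which must agree
    -- with [p-q, p). The probes are its first place m-k and the two places just outside.
    change ∀ x y, x + y + 1 = m → suffixFlip k j y + suffixFlip p q x + 1 = m at K
    suffices q = j ∧ p + k = m + j by omega
    have a₁ := K (m - k) (k - 1) (by omega)
    have a₂ := K (m - k - 1) k (by omega)
    have a₃ := K (m - k + j) (k - j - 1) (by omega)
    have b₁ := suffixFlip_spec u.le (k - 1)
    have b₂ := suffixFlip_spec u.le k
    have b₃ := suffixFlip_spec u.le (k - j - 1)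
    have d₁ : suffixFlip p q (m - k) + k + 1 = m + j := by omega
    have d₂ : suffixFlip p q (m - k - 1) = m - k - 1 := by omega
    have d₃ : suffixFlip p q (m - k + j) = m - k + j := by omega
    clear a₁ a₂ a₃ b₁ b₂ b₃
    have c₁ : m - k < p ∧ p ≤ m - k + q ∧ p + p + k = q + m + j + (m - k) := by
      have := suffixFlip_spec v.le (m - k)
      omega
    have c₂ := suffixFlip_spec v.le (m - k - 1)
    have c₃ := suffixFlip_spec v.le (m - k + j)
    suffices q = j by omega
    rcases c₂ with c₂ | c₂ | c₂ <;> rcases c₃ with c₃ | c₃ | c₃ <;> omega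
  · right; left
    change ∀ x y, x + y + 1 = m → suffixFlip k j y + _ + 1 = m at K
    have a₁ := K 1 (m - 2) (by omega)
    have a₂ := K 2 (m - 3) (by omega)
    suffices k + 1 = m ∧ j = 2 ∧ p = 2 ∧ r = 2 by omega
    rcases blockSwap_spec (by omega) (by omega) v 1 with c₁ | c₁ | c₁ | c₁ <;>
      rcases suffixFlip_spec u.le (m - 2) with b₁ | b₁ | b₁ <;>
      rcases blockSwap_spec (by omega) (by omega) v 2 with c₂ | c₂ | c₂ | c₂ <;>
      rcases suffixFlip_spec u.le (m - 3) with b₂ | b₂ | b₂ <;> omega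
  · right; right; left
    change ∀ x y, x + y + 1 = m → _ + suffixFlip p q x + 1 = m at K
    have a₁ := K (m - 2) 1 (by omega)
    have a₂ := K (m - 3) 2 (by omega)
    suffices p + 1 = m ∧ q = 2 ∧ k = 2 ∧ i = 2 by omega
    rcases blockSwap_spec (by omega) (by omega) u 1 with c₁ | c₁ | c₁ | c₁ <;>
      rcases suffixFlip_spec v.le (m - 2) with b₁ | b₁ | b₁ <;>
      rcases blockSwap_spec (by omega) (by omega) u 2 with c₂ | c₂ | c₂ | c₂ <;>
      rcases suffixFlip_spec v.le (m - 3) with b₂ | b₂ | b₂ <;> omega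
  · right; right; right
    have a₁ := K 1 (m - 2) (by omega)
    have a₂ := K (m - 2) 1 (by omega)
    suffices j + 1 = m ∧ r = k ∧ q + 1 = m by omega
    rcases blockSwap_spec (by omega) (by omega) u 1 with c₁ | c₁ | c₁ | c₁ <;>
      rcases blockSwap_spec (by omega) (by omega) u (m - 2) with b₁ | b₁ | b₁ | b₁ <;>
      rcases blockSwap_spec (by omega) (by omega) v 1 with c₂ | c₂ | c₂ | c₂ <;>
      rcases blockSwap_spec (by omega) (by omega) v (m - 2) with b₂ | b₂ | b₂ | b₂ <;> omega

/-! ### Words, relations and their cyclic symmetries -/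

/-- The composition of the prefix reversals whose lengths are listed. -/
def wordMap : List ℕ → ℕ → ℕ
  | [], x => x
  | a :: l, x => natFlip a (wordMap l x)

@[simp] theorem wordMap_nil (x : ℕ) : wordMap [] x = x := rfl

@[simp] theorem wordMap_cons (a : ℕ) (l : List ℕ) (x : ℕ) :
    wordMap (a :: l) x = natFlip a (wordMap l x) := rfl

theorem wordMap_append (l l' : List ℕ) (x : ℕ) :
    wordMap (l ++ l') x = wordMap l (wordMap l' x) := by
  induction l with
  | nil => rfl
  | cons a l ih => simp [ih]

theorem wordMap_reverse_wordMap (l : List ℕ) (x : ℕ) : wordMap l.reverse (wordMap l x) = x := by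
  induction l generalizing x with
  | nil => rfl
  | cons a l ih => simp [wordMap_append, natFlip_natFlip, ih]

theorem wordMap_of_le {m x : ℕ} {l : List ℕ} (h : ∀ a ∈ l, a ≤ x) (hx : x = m) :
    wordMap l x = m := by
  subst hx
  induction l with
  | nil => rfl
  | cons a l ih =>
    rw [wordMap_cons, ih fun b hb ↦ h b (by simp [hb]), natFlip_of_le (h a (by simp))]

/-- The composition of the listed prefix reversals is the identity. -/
def IsRelation (l : List ℕ) : Prop := ∀ x, wordMap l x = x

theorem IsRelation.rotate {a : ℕ} {l : List ℕ} (h : IsRelation (a :: l)) :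
    IsRelation (l ++ [a]) := by
  intro x
  have := h (natFlip a x)
  rw [wordMap_cons] at this
  simpa [wordMap_append, natFlip_natFlip] using congrArg (natFlip a) this

theorem IsRelation.conj {a : ℕ} {l : List ℕ} (h : IsRelation (a :: (l ++ [a]))) :
    IsRelation l := by
  intro x
  have := h (natFlip a x)
  rw [wordMap_cons, wordMap_append] at this
  simpa [natFlip_natFlip] using congrArg (natFlip a) this

theorem IsRelation.cancel {a : ℕ} {l l' : List ℕ} (h : IsRelation (l ++ a :: a :: l')) :
    IsRelation (l ++ l') := by
  intro x
  have := h x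
  rw [wordMap_append] at this ⊢
  simpa [natFlip_natFlip] using this

theorem isRelation_append_reverse {l l' : List ℕ} (h : ∀ x, wordMap l x = wordMap l' x) :
    IsRelation (l ++ l'.reverse) := by
  intro x
  rw [wordMap_append, h, ← wordMap_append]
  have := wordMap_reverse_wordMap l'.reverse x
  rwa [List.reverse_reverse, ← wordMap_append] at this

/-- The smaller letters leave the place m-1 alone, and the single letter m then sends it to 0. -/
theorem not_isRelation_max {m : ℕ} {l : List ℕ} (hm : 2 ≤ m) (hl : ∀ a ∈ l, a < m) :
    ¬ IsRelation (m :: l) := by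
  intro h
  have h := h (m - 1)
  rw [wordMap_cons, wordMap_of_le (fun a ha ↦ by have := hl a ha; omega) rfl] at h
  have := natFlip_spec m (m - 1)
  omega

/-- Follow the place m-1: `l'` fixes it, m sends it to 0, and the first m can bring it back only if
`l` kept it at 0. -/
theorem isRelation_max_twice {m : ℕ} {l l' : List ℕ} (hm : 2 ≤ m) (hl' : ∀ a ∈ l', a < m)
    (h : IsRelation (m :: (l ++ m :: l'))) : wordMap l 0 = 0 := by
  have h := h (m - 1)
  have e : natFlip m (m - 1) = 0 := natFlip_self_of_add (by omega)
  rw [wordMap_cons, wordMap_append, wordMap_cons,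
    wordMap_of_le (l := l') (fun a ha ↦ by have := hl' a ha; omega) rfl, e] at h
  have := natFlip_spec m (wordMap l 0)
  omega

theorem wordMap_one_zero {a : ℕ} (ha : 2 ≤ a) : wordMap [a] 0 ≠ 0 := by
  have := natFlip_spec a 0
  simp only [wordMap_cons, wordMap_nil]
  omega

theorem wordMap_two_zero {a b : ℕ} (ha : 2 ≤ a) (hb : 2 ≤ b) (hab : a ≠ b) :
    wordMap [a, b] 0 ≠ 0 := by
  have := natFlip_spec b 0
  have := natFlip_spec a (natFlip b 0)
  simp only [wordMap_cons, wordMap_nil]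
  omega

/-! ### Relations of length at most six -/

theorem not_isRelation_one {a : ℕ} (ha : 2 ≤ a) : ¬ IsRelation [a] :=
  fun h ↦ wordMap_one_zero ha (h 0)

theorem not_isRelation_two {a b : ℕ} (ha : 2 ≤ a) (hb : 2 ≤ b) (hab : a ≠ b) :
    ¬ IsRelation [a, b] :=
  fun h ↦ wordMap_two_zero ha hb hab (h 0)

theorem not_isRelation_three {a b c : ℕ} (ha : 2 ≤ a) (hb : 2 ≤ b) (hc : 2 ≤ c)
    (hab : a ≠ b) (hbc : b ≠ c) : ¬ IsRelation [a, b, c] := by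
  intro h
  rcases eq_or_ne a c with rfl | hac
  · exact not_isRelation_one hb (h.conj (l := [b]))
  · rcases three_fix_zero ha hc (h 0) with ⟨rfl, -⟩ | e
    · exact hac rfl
    · have := blockSwap_spec (by omega) (by omega) e 1
      have h1 : natFlip a (natFlip b (natFlip c 1)) = 1 := h 1
      omega

theorem not_isRelation_four {a b c d : ℕ} (ha : 2 ≤ a) (hb : 2 ≤ b) (hc : 2 ≤ c) (hd : 2 ≤ d)
    (hab : a ≠ b) (hbc : b ≠ c) (hcd : c ≠ d) : ¬ IsRelation [a, b, c, d] := by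
  -- Cyclic rotation allows the first letter to be maximal. Equal first and last letters cancel by
  -- conjugation, so neighbours are distinct cyclically.
  suffices key : ∀ {a b c d : ℕ}, 2 ≤ a → 2 ≤ b → 2 ≤ c → 2 ≤ d → b < a → c ≤ a → d < a →
      b ≠ c → ¬ IsRelation [a, b, c, d] by
    intro h
    rcases eq_or_ne a d with rfl | had
    · exact not_isRelation_two hb hc hbc (h.conj (l := [b, c]))
    have h₁ : IsRelation [b, c, d, a] := h.rotate
    have h₂ : IsRelation [c, d, a, b] := h₁.rotate
    have h₃ : IsRelation [d, a, b, c] := h₂.rotate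
    have : (b < a ∧ c ≤ a ∧ d < a) ∨ (c < b ∧ d ≤ b ∧ a < b) ∨ (d < c ∧ a ≤ c ∧ b < c) ∨
      (a < d ∧ b ≤ d ∧ c < d) := by omega
    rcases this with ⟨u, v, w⟩ | ⟨u, v, w⟩ | ⟨u, v, w⟩ | ⟨u, v, w⟩
    · exact key ha hb hc hd u v w hbc h
    · exact key hb hc hd ha u v w hcd h₁
    · exact key hc hd ha hb u v w had.symm h₂
    · exact key hd ha hb hc u v w hab h₃
  intro a b c d ha hb hc hd hba hca hda hbc h
  rcases hca.eq_or_lt with rfl | hca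
  · exact wordMap_one_zero hb (isRelation_max_twice (l := [b]) (l' := [d]) ha (by simp [hda]) h)
  · exact not_isRelation_max ha (by simp [*]) h

theorem not_isRelation_five {a b c d e : ℕ} (ha : 2 ≤ a) (hb : 2 ≤ b) (hc : 2 ≤ c) (hd : 2 ≤ d)
    (he : 2 ≤ e) (hab : a ≠ b) (hbc : b ≠ c) (hcd : c ≠ d) (hde : d ≠ e) :
    ¬ IsRelation [a, b, c, d, e] := by
  suffices key : ∀ {a b c d e : ℕ}, 2 ≤ a → 2 ≤ b → 2 ≤ c → 2 ≤ d → 2 ≤ e → b < a → c ≤ a →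
      d ≤ a → e < a → b ≠ c → c ≠ d → ¬ IsRelation [a, b, c, d, e] by
    intro h
    rcases eq_or_ne a e with rfl | hae
    · exact not_isRelation_three hb hc hd hbc hcd (h.conj (l := [b, c, d]))
    have h₁ : IsRelation [b, c, d, e, a] := h.rotate
    have h₂ : IsRelation [c, d, e, a, b] := h₁.rotate
    have h₃ : IsRelation [d, e, a, b, c] := h₂.rotate
    have h₄ : IsRelation [e, a, b, c, d] := h₃.rotate
    have : (b < a ∧ c ≤ a ∧ d ≤ a ∧ e < a) ∨ (c < b ∧ d ≤ b ∧ e ≤ b ∧ a < b) ∨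
      (d < c ∧ e ≤ c ∧ a ≤ c ∧ b < c) ∨ (e < d ∧ a ≤ d ∧ b ≤ d ∧ c < d) ∨
      (a < e ∧ b ≤ e ∧ c ≤ e ∧ d < e) := by omega
    rcases this with ⟨u, v, w, t⟩ | ⟨u, v, w, t⟩ | ⟨u, v, w, t⟩ | ⟨u, v, w, t⟩ | ⟨u, v, w, t⟩
    · exact key ha hb hc hd he u v w t hbc hcd h
    · exact key hb hc hd he ha u v w t hcd hde h₁
    · exact key hc hd he ha hb u v w t hde hae.symm h₂
    · exact key hd he ha hb hc u v w t hae.symm hab h₃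
    · exact key he ha hb hc hd u v w t hab hbc h₄
  intro a b c d e ha hb hc hd he hba hca hda hea hbc hcd h
  rcases hca.eq_or_lt with rfl | hca
  · exact wordMap_one_zero hb
      (isRelation_max_twice (l := [b]) (l' := [d, e]) ha (by simp; omega) h)
  rcases hda.eq_or_lt with rfl | hda
  · exact wordMap_two_zero hb hc hbc
      (isRelation_max_twice (l := [b, c]) (l' := [e]) ha (by simp; omega) h)
  · exact not_isRelation_max ha (by simp [*]) h

theorem exists_mem_forall_le {l : List ℕ} (hl : l ≠ []) : ∃ m ∈ l, ∀ a ∈ l, a ≤ m := by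
  induction l with
  | nil => exact absurd rfl hl
  | cons b l ih =>
    rcases eq_or_ne l [] with rfl | h
    · exact ⟨b, by simp, by simp⟩
    · obtain ⟨m, hm, hmax⟩ := ih h
      rcases le_total b m with hbm | hmb
      · exact ⟨m, by simp [hm], by simpa [hbm] using hmax⟩
      · exact ⟨b, by simp, by
          simpa using fun a ha ↦ (hmax a ha).trans hmb⟩

/-- Two letters m would leave a block of one or two letters fixing 0, so m takes every other place
and `hexagon_of_three` forces m = 3; the remaining letters are then 2. -/
theorem isRelation_six {a b c d e f : ℕ} (ha : 2 ≤ a) (hb : 2 ≤ b) (hc : 2 ≤ c) (hd : 2 ≤ d)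
    (he : 2 ≤ e) (hf : 2 ≤ f) (hab : a ≠ b) (hbc : b ≠ c) (hcd : c ≠ d) (hde : d ≠ e)
    (hef : e ≠ f) (h : IsRelation [a, b, c, d, e, f]) :
    (a = 3 ∧ b = 2 ∧ c = 3 ∧ d = 2 ∧ e = 3 ∧ f = 2) ∨
      (a = 2 ∧ b = 3 ∧ c = 2 ∧ d = 3 ∧ e = 2 ∧ f = 3) := by
  suffices key : ∀ {a b c d e f : ℕ}, 2 ≤ a → 2 ≤ b → 2 ≤ c → 2 ≤ d → 2 ≤ e → 2 ≤ f →
      b < a → c ≤ a → d ≤ a → e ≤ a → f < a → b ≠ c → c ≠ d → d ≠ e → e ≠ f →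
      IsRelation [a, b, c, d, e, f] → a = 3 ∧ b = 2 ∧ c = 3 ∧ d = 2 ∧ e = 3 ∧ f = 2 by
    rcases eq_or_ne a f with rfl | haf
    · exact absurd (h.conj (l := [b, c, d, e])) (not_isRelation_four hb hc hd he hbc hcd hde)
    have h₁ : IsRelation [b, c, d, e, f, a] := h.rotate
    have h₂ : IsRelation [c, d, e, f, a, b] := h₁.rotate
    have h₃ : IsRelation [d, e, f, a, b, c] := h₂.rotate
    have h₄ : IsRelation [e, f, a, b, c, d] := h₃.rotate
    have h₅ : IsRelation [f, a, b, c, d, e] := h₄.rotate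
    obtain ⟨m, hm, hmax⟩ := exists_mem_forall_le (l := [a, b, c, d, e, f]) (by simp)
    simp only [List.mem_cons, List.not_mem_nil, or_false, forall_eq_or_imp, forall_eq] at hm hmax
    obtain ⟨ma, mb, mc, md, me, mf⟩ := hmax
    rcases hm with rfl | rfl | rfl | rfl | rfl | rfl
    · have := key ha hb hc hd he hf (lt_of_le_of_ne mb (Ne.symm hab)) mc md me (lt_of_le_of_ne mf (haf.symm)) hbc hcd hde hef h
      omega
    · have := key hb hc hd he hf ha (lt_of_le_of_ne mc (Ne.symm hbc)) md me mf (lt_of_le_of_ne ma hab) hcd hde hef haf.symm h₁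
      omega
    · have := key hc hd he hf ha hb (lt_of_le_of_ne md (Ne.symm hcd)) me mf ma (lt_of_le_of_ne mb hbc) hde hef haf.symm hab h₂
      omega
    · have := key hd he hf ha hb hc (lt_of_le_of_ne me (Ne.symm hde)) mf ma mb (lt_of_le_of_ne mc hcd) hef haf.symm hab hbc h₃
      omega
    · have := key he hf ha hb hc hd (lt_of_le_of_ne mf (Ne.symm hef)) ma mb mc (lt_of_le_of_ne md hde) haf.symm hab hbc hcd h₄
      omega
    · have := key hf ha hb hc hd he (lt_of_le_of_ne ma (Ne.symm haf.symm)) mb mc md (lt_of_le_of_ne me hef) hab hbc hcd hde h₅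
      omega
  intro a b c d e f ha hb hc hd he hf hba hca hda hea hfa hbc hcd hde hef h
  rcases hca.eq_or_lt with rfl | hca
  · rcases hea.eq_or_lt with rfl | hea
    · have := hexagon_of_three ⟨hb, hba⟩ ⟨hd, by omega⟩ ⟨hf, hfa⟩ h
      omega
    · exact absurd (isRelation_max_twice (l := [b]) (l' := [d, e, f]) ha (by simp; omega) h)
        (wordMap_one_zero hb)
  rcases hda.eq_or_lt with rfl | hda
  · exact absurd (isRelation_max_twice (l := [b, c]) (l' := [e, f]) ha (by simp; omega) h)
      (wordMap_two_zero hb hc hbc)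
  rcases hea.eq_or_lt with rfl | hea
  · have h' : IsRelation [e, f, e, b, c, d] := h.rotate.rotate.rotate.rotate
    exact absurd (isRelation_max_twice (l := [f]) (l' := [b, c, d]) ha (by simp; omega) h')
      (wordMap_one_zero hf)
  · exact absurd h (not_isRelation_max ha (by simp [*]))

/-! ### Reducible words and the shapes of relations of length seven and eight -/

/-- The words of length four that have the same value as a shorter word or as a word of length four
with a smaller first letter. -/
inductive Reducible : ℕ → ℕ → ℕ → ℕ → Prop
  | nest {a b c d : ℕ} : b = d → c < b → b < a → Reducible a b c d
  | slide {a b c d : ℕ} : a + c = b + d → d < c → c < b → Reducible a b c d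
  | alternate {a b c d : ℕ} : a = c → b < a → d < a → (b + d ≤ a + 1 ∨ b + 1 = a ∨ d + 1 = a) →
      Reducible a b c d
  | ascend_nest {a b c d : ℕ} : b = d → a + 1 = b → c < b → Reducible a b c d
  | wrap_third {a b c d : ℕ} : a = d → c + 1 = a → b + 2 ≤ a → Reducible a b c d
  | wrap_second {a b c d : ℕ} : a = d → b + 1 = a → c + 2 ≤ a → Reducible a b c d
  | nest_pred {a b c d : ℕ} : b = d → c + 1 = b → a + 2 ≤ b → Reducible a b c d
  | split_outer {a b c d : ℕ} : c + 1 = a → b + d = a → Reducible a b c d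
  | split_inner {a b c d : ℕ} : d + 1 = b → a + c = b → Reducible a b c d
  | split_succ {a b c d : ℕ} : a + 1 = c → b + d = c → Reducible a b c d
  | wrap_ascend {a b c d : ℕ} : a = d → c = b + 1 → b + 3 ≤ a → Reducible a b c d
  | wrap_descend {a b c d : ℕ} : a = d → b = c + 1 → c + 3 ≤ a → Reducible a b c d
  | split_pred {a b c d : ℕ} : c + 1 = a → b + d + 1 = a → Reducible a b c d
  | three_two_three {a b c d : ℕ} : a = 3 → b = 2 → c = 3 → 4 ≤ d → Reducible a b c d
  | three_two_pred {a b c d : ℕ} : a = 3 → b = 2 → d + 1 = c → 4 ≤ c → Reducible a b c d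
  | ascend_zigzag {a b c d : ℕ} : a + 1 = b → b = d → c = b + 1 → Reducible a b c d
  | jump_two {a b c d : ℕ} : a + 2 = b → b = d → c = 2 → Reducible a b c d
  | ascend_two_three {a b c d : ℕ} : b = a + 1 → c = 2 → d = 3 → 4 ≤ b → Reducible a b c d
  | head_two_three_two {a b c d : ℕ} : b = 2 → c = 3 → d = 2 → 5 ≤ a → Reducible a b c d

/-- The shapes of the cyclic relations of length eight whose first letter is maximal. -/
inductive OctagonShape (m b c d e f g h : ℕ) : Prop
  | close₁ (h₁ : c = m) (h₂ : e = m)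
    (h₃ : b + d = m + 1 ∧ f + 1 = b ∧ g + 1 = m ∧ h + 1 = d)
  | close₂ (h₁ : c = m) (h₂ : g = m)
    (h₃ : h + b = m + 1 ∧ d + 1 = h ∧ e + 1 = m ∧ f + 1 = b)
  | close₃ (h₁ : e = m) (h₂ : g = m)
    (h₃ : f + h = m + 1 ∧ b + 1 = f ∧ c + 1 = m ∧ d + 1 = h)
  | spread₁ (h₁ : c = m) (h₂ : f = m)
    (h₃ : (d + b = m ∧ e = d + 1 ∧ g + 1 = b ∧ h + 1 = m) ∨
      (d + 1 = m ∧ e + 1 = b ∧ g + b = m + 1 ∧ g = h + 1) ∨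
      (b + 1 = m ∧ d = e + 1 ∧ g + e + 1 = m ∧ h = g + 1))
  | spread₂ (h₁ : d = m) (h₂ : f = m)
    (h₃ : (g + e = m ∧ h = g + 1 ∧ b + 1 = e ∧ c + 1 = m) ∨
      (g + 1 = m ∧ h + 1 = e ∧ b + e = m + 1 ∧ b = c + 1) ∨
      (e + 1 = m ∧ g = h + 1 ∧ b + h + 1 = m ∧ c = b + 1))
  | spread₃ (h₁ : d = m) (h₂ : g = m)
    (h₃ : (b + h = m ∧ c = b + 1 ∧ e + 1 = h ∧ f + 1 = m) ∨
      (b + 1 = m ∧ c + 1 = h ∧ e + h = m + 1 ∧ e = f + 1) ∨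
      (h + 1 = m ∧ b = c + 1 ∧ e + c + 1 = m ∧ f = e + 1))
  | four (h₁ : c = m) (h₂ : e = m) (h₃ : g = m)
    (h₄ : b = f ∧ d = h ∧ (b + d ≤ m ∨ (m = 4 ∧ b = 3 ∧ d = 3)))
  | two (h₁ : e = m)
    (h₂ : (d = b ∧ c < b ∧ h = f ∧ g = c ∧ f + b = m + c) ∨
      (b + 1 = m ∧ c = 2 ∧ d + 1 = m ∧ f = 2 ∧ g = 3 ∧ h = 2) ∨
      (b = 2 ∧ c = 3 ∧ d = 2 ∧ f + 1 = m ∧ g = 2 ∧ h + 1 = m) ∨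
      (c + 1 = m ∧ g + 1 = m ∧ b + d = m ∧ f = b ∧ h = d))

theorem octagonShape_of_isRelation {m b c d e f g h : ℕ} (hb : 2 ≤ b) (hc : 2 ≤ c) (hd : 2 ≤ d)
    (he : 2 ≤ e) (hf : 2 ≤ f) (hg : 2 ≤ g) (hh : 2 ≤ h) (mb : b < m) (mc : c ≤ m) (md : d ≤ m)
    (me : e ≤ m) (mf : f ≤ m) (mg : g ≤ m) (mh : h < m) (hbc : b ≠ c) (hcd : c ≠ d) (hde : d ≠ e)
    (hef : e ≠ f) (hfg : f ≠ g) (hgh : g ≠ h) (H : IsRelation [m, b, c, d, e, f, g, h]) :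
    OctagonShape m b c d e f g h := by
  have hm : 2 ≤ m := by omega
  rcases mc.eq_or_lt with rfl | mc
  · rcases me.eq_or_lt with rfl | me
    · rcases mg.eq_or_lt with rfl | mg
      · exact .four rfl rfl rfl (octagon_of_four ⟨hb, mb⟩ ⟨hd, by omega⟩ ⟨hf, by omega⟩ ⟨hh, mh⟩ H)
      · exact .close₁ rfl rfl (octagon_of_three_close ⟨hb, mb⟩ ⟨hd, by omega⟩ ⟨hf, by omega⟩ ⟨hg, mg⟩ ⟨hh, mh⟩
          hfg hgh H)
    · rcases mf.eq_or_lt with rfl | mf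
      · exact .spread₁ rfl rfl (octagon_of_three_spread ⟨hb, mb⟩ ⟨hd, by omega⟩ ⟨he, me⟩ ⟨hg, by omega⟩ ⟨hh, mh⟩
          hde hgh H)
      · rcases mg.eq_or_lt with rfl | mg
        · exact .close₂ rfl rfl (octagon_of_three_close ⟨hh, mh⟩ ⟨hb, mb⟩ ⟨hd, by omega⟩ ⟨he, me⟩ ⟨hf, mf⟩
            hde hef H.rotate.rotate.rotate.rotate.rotate.rotate)
        · exact absurd (isRelation_max_twice (l := [b]) (l' := [d, e, f, g, h]) hm
            (by simp; omega) H) (wordMap_one_zero hb)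
  rcases md.eq_or_lt with rfl | md
  · rcases mf.eq_or_lt with rfl | mf
    · exact .spread₂ rfl rfl (octagon_of_three_spread ⟨he, by omega⟩ ⟨hg, by omega⟩ ⟨hh, mh⟩ ⟨hb, mb⟩ ⟨hc, mc⟩
          hgh hbc H.rotate.rotate.rotate)
    · rcases mg.eq_or_lt with rfl | mg
      · exact .spread₃ rfl rfl (octagon_of_three_spread ⟨hh, mh⟩ ⟨hb, mb⟩ ⟨hc, mc⟩ ⟨he, by omega⟩ ⟨hf, mf⟩
          hbc hef H.rotate.rotate.rotate.rotate.rotate.rotate)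
      · exact absurd (isRelation_max_twice (l := [b, c]) (l' := [e, f, g, h]) hm
          (by simp; omega) H) (wordMap_two_zero hb hc hbc)
  rcases me.eq_or_lt with rfl | me
  · rcases mg.eq_or_lt with rfl | mg
    · exact .close₃ rfl rfl (octagon_of_three_close ⟨hf, by omega⟩ ⟨hh, mh⟩ ⟨hb, mb⟩ ⟨hc, mc⟩ ⟨hd, md⟩
          hbc hcd H.rotate.rotate.rotate.rotate)
    · have H' : IsRelation [e, f, g, h, e, b, c, d] := H.rotate.rotate.rotate.rotate
      have h₁ := isRelation_max_twice (l := [b, c, d]) (l' := [f, g, h]) hm (by simp; omega) H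
      have h₂ := isRelation_max_twice (l := [f, g, h]) (l' := [b, c, d]) hm (by simp; omega) H'
      exact .two rfl (octagon_of_two ⟨hb, mb⟩ ⟨hc, mc⟩ ⟨hd, md⟩ ⟨hf, by omega⟩ ⟨hg, mg⟩ ⟨hh, mh⟩
        h₁ (by
          -- `octagon_of_two` wants the inverse of this block to fix 0, which follows because the
          -- block itself does.
          have h₃ := wordMap_reverse_wordMap [f, g, h] 0
          rwa [h₂] at h₃) H)
  rcases mf.eq_or_lt with rfl | mf
  · have H' : IsRelation [f, g, h, f, b, c, d, e] := H.rotate.rotate.rotate.rotate.rotate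
    exact absurd (isRelation_max_twice (l := [g, h]) (l' := [b, c, d, e]) hm
      (by simp; omega) H') (wordMap_two_zero hg hh hgh)
  rcases mg.eq_or_lt with rfl | mg
  · have H' : IsRelation [g, h, g, b, c, d, e, f] := H.rotate.rotate.rotate.rotate.rotate.rotate
    exact absurd (isRelation_max_twice (l := [h]) (l' := [b, c, d, e, f]) hm
      (by simp; omega) H') (wordMap_one_zero hh)
  · exact absurd H (not_isRelation_max hm (by simp [*]))

/-- The shapes of the cyclic relations of length seven whose first letter is maximal. -/
inductive HeptagonShape (m b c d e f g : ℕ) : Prop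
  | spread₁ (h₁ : c = m) (h₂ : e = m)
    (h₃ : (b = 2 ∧ d + 1 = m ∧ f + 1 = m ∧ g + 2 = m) ∨
      (b + 1 = m ∧ d = 2 ∧ f + 2 = m ∧ g + 1 = m))
  | spread₂ (h₁ : c = m) (h₂ : f = m)
    (h₃ : (g = 2 ∧ b + 1 = m ∧ d + 1 = m ∧ e + 2 = m) ∨
      (g + 1 = m ∧ b = 2 ∧ d + 2 = m ∧ e + 1 = m))
  | spread₃ (h₁ : d = m) (h₂ : f = m)
    (h₃ : (e = 2 ∧ g + 1 = m ∧ b + 1 = m ∧ c + 2 = m) ∨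
      (e + 1 = m ∧ g = 2 ∧ b + 2 = m ∧ c + 1 = m))

theorem heptagonShape_of_isRelation {m b c d e f g : ℕ} (hb : 2 ≤ b) (hc : 2 ≤ c) (hd : 2 ≤ d)
    (he : 2 ≤ e) (hf : 2 ≤ f) (hg : 2 ≤ g) (mb : b < m) (mc : c ≤ m) (md : d ≤ m)
    (me : e ≤ m) (mf : f ≤ m) (mg : g < m) (hbc : b ≠ c) (hcd : c ≠ d) (hde : d ≠ e)
    (hef : e ≠ f) (hfg : f ≠ g) (H : IsRelation [m, b, c, d, e, f, g]) :
    HeptagonShape m b c d e f g := by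
  have hm : 2 ≤ m := by omega
  rcases mc.eq_or_lt with rfl | mc
  · rcases me.eq_or_lt with rfl | me
    · exact .spread₁ rfl rfl (heptagon_of_three ⟨hb, mb⟩ ⟨hd, by omega⟩ ⟨hf, by omega⟩ ⟨hg, mg⟩ hfg H)
    · rcases mf.eq_or_lt with rfl | mf
      · exact .spread₂ rfl rfl (heptagon_of_three ⟨hg, mg⟩ ⟨hb, mb⟩ ⟨hd, by omega⟩ ⟨he, me⟩ hde
          H.rotate.rotate.rotate.rotate.rotate)
      · exact absurd (isRelation_max_twice (l := [b]) (l' := [d, e, f, g]) hm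
          (by simp; omega) H) (wordMap_one_zero hb)
  rcases md.eq_or_lt with rfl | md
  · rcases mf.eq_or_lt with rfl | mf
    · exact .spread₃ rfl rfl (heptagon_of_three ⟨he, by omega⟩ ⟨hg, mg⟩ ⟨hb, mb⟩ ⟨hc, mc⟩ hbc H.rotate.rotate.rotate)
    · exact absurd (isRelation_max_twice (l := [b, c]) (l' := [e, f, g]) hm
        (by simp; omega) H) (wordMap_two_zero hb hc hbc)
  rcases me.eq_or_lt with rfl | me
  · have H' : IsRelation [e, f, g, e, b, c, d] := H.rotate.rotate.rotate.rotate
    exact absurd (isRelation_max_twice (l := [f, g]) (l' := [b, c, d]) hm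
      (by simp; omega) H') (wordMap_two_zero hf hg hfg)
  rcases mf.eq_or_lt with rfl | mf
  · have H' : IsRelation [f, g, f, b, c, d, e] := H.rotate.rotate.rotate.rotate.rotate
    exact absurd (isRelation_max_twice (l := [g]) (l' := [b, c, d, e]) hm
      (by simp; omega) H') (wordMap_one_zero hg)
  · exact absurd H (not_isRelation_max hm (by simp [*]))

/-- The word 4 2 3 2 already belongs to `split_outer`, so `head_two_three_two` starts at 5 to keep
the families disjoint. -/
theorem Reducible.two_three_two {a b c d : ℕ} (ha : 4 ≤ a) (hb : b = 2) (hc : c = 3) (hd : d = 2) :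
    Reducible a b c d := by
  rcases ha.eq_or_lt with rfl | ha
  · exact .split_outer (by omega) (by omega)
  · exact .head_two_three_two hb hc hd ha

/-- The relation says that abcd and a'b'c'd' have equal value, and the half with the larger first
letter is the reducible one. It suffices to have the maximal letter in the first half, the other
case being the reversed relation. -/
theorem reducible_of_octagonShape {a b c d a' b' c' d' : ℕ} (ha : 2 ≤ a) (hb : 2 ≤ b) (hc : 2 ≤ c)
    (hd : 2 ≤ d) (ha' : 2 ≤ a') (hb' : 2 ≤ b') (hc' : 2 ≤ c') (hd' : 2 ≤ d')
    (hbc : b ≠ c) (hcd : c ≠ d) (hdd : d ≠ d') (hcd' : c' ≠ d') (hbc' : b' ≠ c')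
    (hab' : a' ≠ b')
    (h : (b ≤ a ∧ c ≤ a ∧ d ≤ a ∧ d' ≤ a ∧ c' ≤ a ∧ b' ≤ a ∧ a' ≤ a) ∧ OctagonShape a b c d d' c' b' a' ∨
      (c ≤ b ∧ d ≤ b ∧ d' ≤ b ∧ c' ≤ b ∧ b' ≤ b ∧ a' ≤ b ∧ a ≤ b) ∧ OctagonShape b c d d' c' b' a' a ∨
      (d ≤ c ∧ d' ≤ c ∧ c' ≤ c ∧ b' ≤ c ∧ a' ≤ c ∧ a ≤ c ∧ b ≤ c) ∧ OctagonShape c d d' c' b' a' a b ∨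
      (d' ≤ d ∧ c' ≤ d ∧ b' ≤ d ∧ a' ≤ d ∧ a ≤ d ∧ b ≤ d ∧ c ≤ d) ∧ OctagonShape d d' c' b' a' a b c) :
    (a' < a → Reducible a b c d) ∧ (a < a' → Reducible a' b' c' d') := by
  rcases h with ⟨hmax, h⟩ | ⟨hmax, h⟩ | ⟨hmax, h⟩ | ⟨hmax, h⟩ <;>
  rcases h with ⟨_, _, _⟩ | ⟨_, _, _⟩ | ⟨_, _, _⟩ | ⟨_, _, _ | _ | _⟩ | ⟨_, _, _ | _ | _⟩ |
    ⟨_, _, _ | _ | _⟩ | ⟨_, _, _, _, _, _ | _⟩ | ⟨_, _ | _ | _ | _⟩ <;>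
    constructor <;> intro hlt <;>
    first
    | omega
    | exact .nest (by omega) (by omega) (by omega)
    | exact .slide (by omega) (by omega) (by omega)
    | exact .alternate (by omega) (by omega) (by omega) (by omega)
    | exact .ascend_nest (by omega) (by omega) (by omega)
    | exact .wrap_third (by omega) (by omega) (by omega)
    | exact .wrap_second (by omega) (by omega) (by omega)
    | exact .nest_pred (by omega) (by omega) (by omega)
    | exact .split_outer (by omega) (by omega)
    | exact .split_inner (by omega) (by omega)
    | exact .split_succ (by omega) (by omega)
    | exact .wrap_ascend (by omega) (by omega) (by omega)
    | exact .wrap_descend (by omega) (by omega) (by omega)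
    | exact .split_pred (by omega) (by omega)
    | exact .three_two_three (by omega) (by omega) (by omega) (by omega)
    | exact .three_two_pred (by omega) (by omega) (by omega) (by omega)
    | exact .ascend_zigzag (by omega) (by omega) (by omega)
    | exact .jump_two (by omega) (by omega) (by omega)
    | exact .ascend_two_three (by omega) (by omega) (by omega) (by omega)
    | exact .two_three_two (by omega) (by omega) (by omega) (by omega)

/-- Here abcd has the value of the three-letter word efg. The halves are of unequal length, so no
reversal symmetry is available and all seven positions of the maximum are needed. -/
theorem reducible_of_heptagonShape {a b c d e f g : ℕ} (hd : 2 ≤ d) (he : 2 ≤ e) (hf : 2 ≤ f)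
    (hg : 2 ≤ g)
    (h : (b ≤ a ∧ c ≤ a ∧ d ≤ a ∧ g ≤ a ∧ f ≤ a ∧ e ≤ a) ∧ HeptagonShape a b c d g f e ∨
      (c ≤ b ∧ d ≤ b ∧ g ≤ b ∧ f ≤ b ∧ e ≤ b ∧ a ≤ b) ∧ HeptagonShape b c d g f e a ∨
      (d ≤ c ∧ g ≤ c ∧ f ≤ c ∧ e ≤ c ∧ a ≤ c ∧ b ≤ c) ∧ HeptagonShape c d g f e a b ∨
      (g ≤ d ∧ f ≤ d ∧ e ≤ d ∧ a ≤ d ∧ b ≤ d ∧ c ≤ d) ∧ HeptagonShape d g f e a b c ∨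
      (f ≤ g ∧ e ≤ g ∧ a ≤ g ∧ b ≤ g ∧ c ≤ g ∧ d ≤ g) ∧ HeptagonShape g f e a b c d ∨
      (e ≤ f ∧ a ≤ f ∧ b ≤ f ∧ c ≤ f ∧ d ≤ f ∧ g ≤ f) ∧ HeptagonShape f e a b c d g ∨
      (a ≤ e ∧ b ≤ e ∧ c ≤ e ∧ d ≤ e ∧ g ≤ e ∧ f ≤ e) ∧ HeptagonShape e a b c d g f) :
    Reducible a b c d := by
  rcases h with ⟨hmax, h⟩ | ⟨hmax, h⟩ | ⟨hmax, h⟩ | ⟨hmax, h⟩ |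
    ⟨hmax, h⟩ | ⟨hmax, h⟩ | ⟨hmax, h⟩ <;>
  rcases h with ⟨_, _, _ | _⟩ | ⟨_, _, _ | _⟩ | ⟨_, _, _ | _⟩ <;>
    first
    | omega
    | exact .nest (by omega) (by omega) (by omega)
    | exact .slide (by omega) (by omega) (by omega)
    | exact .alternate (by omega) (by omega) (by omega) (by omega)
    | exact .ascend_nest (by omega) (by omega) (by omega)
    | exact .wrap_third (by omega) (by omega) (by omega)
    | exact .wrap_second (by omega) (by omega) (by omega)
    | exact .nest_pred (by omega) (by omega) (by omega)
    | exact .split_outer (by omega) (by omega)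
    | exact .split_inner (by omega) (by omega)
    | exact .split_succ (by omega) (by omega)
    | exact .wrap_ascend (by omega) (by omega) (by omega)
    | exact .wrap_descend (by omega) (by omega) (by omega)
    | exact .split_pred (by omega) (by omega)
    | exact .three_two_three (by omega) (by omega) (by omega) (by omega)
    | exact .three_two_pred (by omega) (by omega) (by omega) (by omega)
    | exact .ascend_zigzag (by omega) (by omega) (by omega)
    | exact .jump_two (by omega) (by omega) (by omega)

theorem IsRelation.reverse {l : List ℕ} (h : IsRelation l) : IsRelation l.reverse := by
  intro x
  have := wordMap_reverse_wordMap l x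
  rwa [h] at this

theorem reducible_of_isRelation_seven {a b c d e f g : ℕ} (ha : 2 ≤ a) (hb : 2 ≤ b) (hc : 2 ≤ c)
    (hd : 2 ≤ d) (he : 2 ≤ e) (hf : 2 ≤ f) (hg : 2 ≤ g) (hab : a ≠ b) (hbc : b ≠ c) (hcd : c ≠ d)
    (hdg : d ≠ g) (hfg : f ≠ g) (hef : e ≠ f) (h : IsRelation [a, b, c, d, g, f, e]) :
    Reducible a b c d := by
  rcases eq_or_ne a e with rfl | hae
  · exact absurd (h.conj (l := [b, c, d, g, f]))
      (not_isRelation_five hb hc hd hg hf hbc hcd hdg hfg.symm)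
  have h₁ : IsRelation [b, c, d, g, f, e, a] := h.rotate
  have h₂ : IsRelation [c, d, g, f, e, a, b] := h₁.rotate
  have h₃ : IsRelation [d, g, f, e, a, b, c] := h₂.rotate
  have h₄ : IsRelation [g, f, e, a, b, c, d] := h₃.rotate
  have h₅ : IsRelation [f, e, a, b, c, d, g] := h₄.rotate
  have h₆ : IsRelation [e, a, b, c, d, g, f] := h₅.rotate
  obtain ⟨m, hm, hmax⟩ := exists_mem_forall_le (l := [a, b, c, d, g, f, e]) (by simp)
  simp only [List.mem_cons, List.not_mem_nil, or_false, forall_eq_or_imp, forall_eq] at hm hmax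
  obtain ⟨ma, mb, mc, md, mg, mf, me⟩ := hmax
  rcases hm with rfl | rfl | rfl | rfl | rfl | rfl | rfl
  · exact reducible_of_heptagonShape hd he hf hg
      (.inl ⟨⟨mb, mc, md, mg, mf, me⟩,
      heptagonShape_of_isRelation hb hc hd hg hf he
      (lt_of_le_of_ne mb (Ne.symm hab)) mc md mg mf
      (lt_of_le_of_ne me hae.symm)
      hbc hcd hdg hfg.symm hef.symm h⟩)
  · exact reducible_of_heptagonShape hd he hf hg
      (.inr <| .inl ⟨⟨mc, md, mg, mf, me, ma⟩,
      heptagonShape_of_isRelation hc hd hg hf he ha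
      (lt_of_le_of_ne mc (Ne.symm hbc)) md mg mf me
      (lt_of_le_of_ne ma hab)
      hcd hdg hfg.symm hef.symm hae.symm h₁⟩)
  · exact reducible_of_heptagonShape hd he hf hg
      (.inr <| .inr <| .inl ⟨⟨md, mg, mf, me, ma, mb⟩,
      heptagonShape_of_isRelation hd hg hf he ha hb
      (lt_of_le_of_ne md (Ne.symm hcd)) mg mf me ma
      (lt_of_le_of_ne mb hbc)
      hdg hfg.symm hef.symm hae.symm hab h₂⟩)
  · exact reducible_of_heptagonShape hd he hf hg
      (.inr <| .inr <| .inr <| .inl ⟨⟨mg, mf, me, ma, mb, mc⟩,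
      heptagonShape_of_isRelation hg hf he ha hb hc
      (lt_of_le_of_ne mg (Ne.symm hdg)) mf me ma mb
      (lt_of_le_of_ne mc hcd)
      hfg.symm hef.symm hae.symm hab hbc h₃⟩)
  · exact reducible_of_heptagonShape hd he hf hg
      (.inr <| .inr <| .inr <| .inr <| .inl ⟨⟨mf, me, ma, mb, mc, md⟩,
      heptagonShape_of_isRelation hf he ha hb hc hd
      (lt_of_le_of_ne mf hfg) me ma mb mc
      (lt_of_le_of_ne md hdg)
      hef.symm hae.symm hab hbc hcd h₄⟩)
  · exact reducible_of_heptagonShape hd he hf hg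
      (.inr <| .inr <| .inr <| .inr <| .inr <| .inl ⟨⟨me, ma, mb, mc, md, mg⟩,
      heptagonShape_of_isRelation he ha hb hc hd hg
      (lt_of_le_of_ne me hef) ma mb mc md
      (lt_of_le_of_ne mg hfg.symm)
      hae.symm hab hbc hcd hdg h₅⟩)
  · exact reducible_of_heptagonShape hd he hf hg
      (.inr <| .inr <| .inr <| .inr <| .inr <| .inr <| ⟨⟨ma, mb, mc, md, mg, mf⟩,
      heptagonShape_of_isRelation ha hb hc hd hg hf
      (lt_of_le_of_ne ma hae) mb mc md mg
      (lt_of_le_of_ne mf hef.symm)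
      hab hbc hcd hdg hfg.symm h₆⟩)

theorem reducible_of_isRelation_eight {a b c d a' b' c' d' : ℕ} (ha : 2 ≤ a) (hb : 2 ≤ b)
    (hc : 2 ≤ c) (hd : 2 ≤ d) (ha' : 2 ≤ a') (hb' : 2 ≤ b') (hc' : 2 ≤ c') (hd' : 2 ≤ d')
    (hab : a ≠ b) (hbc : b ≠ c) (hcd : c ≠ d) (hdd : d ≠ d') (hcd' : c' ≠ d') (hbc' : b' ≠ c')
    (hab' : a' ≠ b') (haa : a ≠ a') (h : IsRelation [a, b, c, d, d', c', b', a']) :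
    (a' < a → Reducible a b c d) ∧ (a < a' → Reducible a' b' c' d') := by
  have k : IsRelation [a', b', c', d', d, c, b, a] := h.reverse
  have k₁ : IsRelation [b', c', d', d, c, b, a, a'] := k.rotate
  have k₂ : IsRelation [c', d', d, c, b, a, a', b'] := k₁.rotate
  have k₃ : IsRelation [d', d, c, b, a, a', b', c'] := k₂.rotate
  have h₁ : IsRelation [b, c, d, d', c', b', a', a] := h.rotate
  have h₂ : IsRelation [c, d, d', c', b', a', a, b] := h₁.rotate
  have h₃ : IsRelation [d, d', c', b', a', a, b, c] := h₂.rotate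
  have h₄ : IsRelation [d', c', b', a', a, b, c, d] := h₃.rotate
  have h₅ : IsRelation [c', b', a', a, b, c, d, d'] := h₄.rotate
  have h₆ : IsRelation [b', a', a, b, c, d, d', c'] := h₅.rotate
  have h₇ : IsRelation [a', a, b, c, d, d', c', b'] := h₆.rotate
  obtain ⟨m, hm, hmax⟩ := exists_mem_forall_le (l := [a, b, c, d, d', c', b', a']) (by simp)
  simp only [List.mem_cons, List.not_mem_nil, or_false, forall_eq_or_imp, forall_eq] at hm hmax
  obtain ⟨ma, mb, mc, md, md', mc', mb', ma'⟩ := hmax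
  rcases hm with rfl | rfl | rfl | rfl | rfl | rfl | rfl | rfl
  · exact reducible_of_octagonShape ha hb hc hd ha' hb' hc' hd' hbc hcd hdd hcd' hbc' hab'
      (.inl ⟨⟨mb, mc, md, md', mc', mb', ma'⟩,
      octagonShape_of_isRelation hb hc hd hd' hc' hb' ha'
      (lt_of_le_of_ne mb (Ne.symm hab)) mc md md' mc' mb'
      (lt_of_le_of_ne ma' haa.symm)
      hbc hcd hdd hcd'.symm hbc'.symm hab'.symm h⟩)
  · exact reducible_of_octagonShape ha hb hc hd ha' hb' hc' hd' hbc hcd hdd hcd' hbc' hab'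
      (.inr <| .inl ⟨⟨mc, md, md', mc', mb', ma', ma⟩,
      octagonShape_of_isRelation hc hd hd' hc' hb' ha' ha
      (lt_of_le_of_ne mc (Ne.symm hbc)) md md' mc' mb' ma'
      (lt_of_le_of_ne ma hab)
      hcd hdd hcd'.symm hbc'.symm hab'.symm haa.symm h₁⟩)
  · exact reducible_of_octagonShape ha hb hc hd ha' hb' hc' hd' hbc hcd hdd hcd' hbc' hab'
      (.inr <| .inr <| .inl ⟨⟨md, md', mc', mb', ma', ma, mb⟩,
      octagonShape_of_isRelation hd hd' hc' hb' ha' ha hb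
      (lt_of_le_of_ne md (Ne.symm hcd)) md' mc' mb' ma' ma
      (lt_of_le_of_ne mb hbc)
      hdd hcd'.symm hbc'.symm hab'.symm haa.symm hab h₂⟩)
  · exact reducible_of_octagonShape ha hb hc hd ha' hb' hc' hd' hbc hcd hdd hcd' hbc' hab'
      (.inr <| .inr <| .inr <| ⟨⟨md', mc', mb', ma', ma, mb, mc⟩,
      octagonShape_of_isRelation hd' hc' hb' ha' ha hb hc
      (lt_of_le_of_ne md' (Ne.symm hdd)) mc' mb' ma' ma mb
      (lt_of_le_of_ne mc hcd)
      hcd'.symm hbc'.symm hab'.symm haa.symm hab hbc h₃⟩)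
  · exact (reducible_of_octagonShape ha' hb' hc' hd' ha hb hc hd hbc' hcd' hdd.symm hcd hbc hab
      (.inr <| .inr <| .inr <| ⟨⟨md, mc, mb, ma, ma', mb', mc'⟩,
      octagonShape_of_isRelation hd hc hb ha ha' hb' hc'
      (lt_of_le_of_ne md hdd) mc mb ma ma' mb'
      (lt_of_le_of_ne mc' hcd')
      hcd.symm hbc.symm hab.symm haa hab' hbc' k₃⟩)).symm
  · exact (reducible_of_octagonShape ha' hb' hc' hd' ha hb hc hd hbc' hcd' hdd.symm hcd hbc hab
      (.inr <| .inr <| .inl ⟨⟨md', md, mc, mb, ma, ma', mb'⟩,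
      octagonShape_of_isRelation hd' hd hc hb ha ha' hb'
      (lt_of_le_of_ne md' (Ne.symm hcd')) md mc mb ma ma'
      (lt_of_le_of_ne mb' hbc')
      hdd.symm hcd.symm hbc.symm hab.symm haa hab' k₂⟩)).symm
  · exact (reducible_of_octagonShape ha' hb' hc' hd' ha hb hc hd hbc' hcd' hdd.symm hcd hbc hab
      (.inr <| .inl ⟨⟨mc', md', md, mc, mb, ma, ma'⟩,
      octagonShape_of_isRelation hc' hd' hd hc hb ha ha'
      (lt_of_le_of_ne mc' (Ne.symm hbc')) md' md mc mb ma
      (lt_of_le_of_ne ma' hab')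
      hcd' hdd.symm hcd.symm hbc.symm hab.symm haa k₁⟩)).symm
  · exact (reducible_of_octagonShape ha' hb' hc' hd' ha hb hc hd hbc' hcd' hdd.symm hcd hbc hab
      (.inl ⟨⟨mb', mc', md', md, mc, mb, ma⟩,
      octagonShape_of_isRelation hb' hc' hd' hd hc hb ha
      (lt_of_le_of_ne mb' (Ne.symm hab')) mc' md' md mc mb
      (lt_of_le_of_ne ma haa)
      hbc' hcd' hdd.symm hcd.symm hbc.symm hab.symm k⟩)).symm

/-- Appending the reversed shorter word gives a relation of length at most seven. Cancelling equal
neighbours at the junction leads to an excluded length, to the alternation of 2 and 3, or to length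
seven. -/
theorem reducible_of_shorter {a b c d : ℕ} {l : List ℕ} (ha : 2 ≤ a) (hb : 2 ≤ b) (hc : 2 ≤ c)
    (hd : 2 ≤ d) (hab : a ≠ b) (hbc : b ≠ c) (hcd : c ≠ d) (hl : ∀ x ∈ l, 2 ≤ x)
    (hlen : l.length < 4) (h : ∀ x, wordMap [a, b, c, d] x = wordMap l x) : Reducible a b c d := by
  have zero : (∀ x, wordMap [a, b, c, d] x = wordMap [] x) → Reducible a b c d := fun h ↦
    absurd (isRelation_append_reverse h) (not_isRelation_four ha hb hc hd hab hbc hcd)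
  have one : ∀ {e}, 2 ≤ e → (∀ x, wordMap [a, b, c, d] x = wordMap [e] x) → Reducible a b c d := by
    intro e he h
    have r : IsRelation [a, b, c, d, e] := isRelation_append_reverse h
    rcases eq_or_ne d e with rfl | hde
    · exact absurd (r.cancel (l := [a, b, c]) (l' := [])) (not_isRelation_three ha hb hc hab hbc)
    · exact absurd r (not_isRelation_five ha hb hc hd he hab hbc hcd hde)
  match l, hlen with
  | [], _ => exact zero h
  | [e], _ => exact one (hl e (by simp)) h
  | [e, f], _ =>
    have he : 2 ≤ e := hl e (by simp)
    have hf : 2 ≤ f := hl f (by simp)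
    rcases eq_or_ne e f with rfl | hef
    · exact zero (by simpa [natFlip_natFlip] using h)
    have r : IsRelation [a, b, c, d, f, e] := isRelation_append_reverse h
    rcases eq_or_ne d f with rfl | hdf
    · have r : IsRelation [a, b, c, e] := r.cancel (l := [a, b, c]) (l' := [e])
      rcases eq_or_ne c e with rfl | hce
      · exact absurd (r.cancel (l := [a, b]) (l' := [])) (not_isRelation_two ha hb hab)
      · exact absurd r (not_isRelation_four ha hb hc he hab hbc hce)
    · rcases isRelation_six ha hb hc hd hf he hab hbc hcd hdf hef.symm r with h | h
      · exact .alternate (by omega) (by omega) (by omega) (by omega)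
      · exact .ascend_nest (by omega) (by omega) (by omega)
  | [e, f, g], _ =>
    have he : 2 ≤ e := hl e (by simp)
    have hf : 2 ≤ f := hl f (by simp)
    have hg : 2 ≤ g := hl g (by simp)
    rcases eq_or_ne e f with rfl | hef
    · exact one hg (by simpa [natFlip_natFlip] using h)
    rcases eq_or_ne f g with rfl | hfg
    · exact one he (by simpa [natFlip_natFlip] using h)
    have r : IsRelation [a, b, c, d, g, f, e] := isRelation_append_reverse h
    rcases eq_or_ne d g with rfl | hdg
    · have r : IsRelation [a, b, c, f, e] := r.cancel (l := [a, b, c]) (l' := [f, e])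
      rcases eq_or_ne c f with rfl | hcf
      · have r : IsRelation [a, b, e] := r.cancel (l := [a, b]) (l' := [e])
        rcases eq_or_ne b e with rfl | hbe
        · exact absurd (r.cancel (l := [a]) (l' := [])) (not_isRelation_one ha)
        · exact absurd r (not_isRelation_three ha hb he hab hbe)
      · exact absurd r (not_isRelation_five ha hb hc hf he hab hbc hcf hef.symm)
    · exact reducible_of_isRelation_seven ha hb hc hd he hf hg hab hbc hcd hdg hfg hef r

/-- Common last or first letters cancel, leaving a relation of length six, which is 323 = 232 with a
letter attached at one end; otherwise the relation has length eight and is cyclically reduced. -/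
theorem reducible_of_wordMap_eq {a b c d a' b' c' d' : ℕ} (ha : 2 ≤ a) (hb : 2 ≤ b)
    (hc : 2 ≤ c) (hd : 2 ≤ d) (ha' : 2 ≤ a') (hb' : 2 ≤ b') (hc' : 2 ≤ c') (hd' : 2 ≤ d')
    (hab : a ≠ b) (hbc : b ≠ c) (hcd : c ≠ d) (hab' : a' ≠ b') (hbc' : b' ≠ c') (hcd' : c' ≠ d')
    (h : ∀ x, wordMap [a, b, c, d] x = wordMap [a', b', c', d'] x)
    (hne : (a, b, c, d) ≠ (a', b', c', d')) :
    Reducible a b c d ∨ Reducible a' b' c' d' := by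
  have r : IsRelation [a, b, c, d, d', c', b', a'] := isRelation_append_reverse h
  rcases eq_or_ne d d' with rfl | hdd
  · have r : IsRelation [a, b, c, c', b', a'] := r.cancel (l := [a, b, c]) (l' := [c', b', a'])
    rcases eq_or_ne c c' with rfl | hcc
    · have r : IsRelation [a, b, b', a'] := r.cancel (l := [a, b]) (l' := [b', a'])
      rcases eq_or_ne b b' with rfl | hbb
      · have r : IsRelation [a, a'] := r.cancel (l := [a]) (l' := [a'])
        rcases eq_or_ne a a' with rfl | haa
        · exact absurd rfl hne
        · exact absurd r (not_isRelation_two ha ha' haa)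
      · exact absurd r (not_isRelation_four ha hb hb' ha' hab hbb hab'.symm)
    · rcases isRelation_six ha hb hc hc' hb' ha' hab hbc hcc hbc'.symm hab'.symm r with h | h
      · rcases (show d = 2 ∨ 4 ≤ d by omega) with hd | hd
        · exact .inl (.alternate (by omega) (by omega) (by omega) (by omega))
        · exact .inl (.three_two_three (by omega) (by omega) (by omega) hd)
      · rcases (show d = 2 ∨ 4 ≤ d by omega) with hd | hd
        · omega
        · exact .inr (.three_two_three (by omega) (by omega) (by omega) hd)
  · rcases eq_or_ne a a' with rfl | haa
    · have r : IsRelation [b, c, d, d', c', b'] := r.conj (l := [b, c, d, d', c', b'])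
      rcases isRelation_six hb hc hd hd' hc' hb' hbc hcd hdd hcd'.symm hbc'.symm r with h | h
      · rcases (show a = 2 ∨ 4 ≤ a by omega) with ha | ha
        · omega
        · exact .inr (.two_three_two ha (by omega) (by omega) (by omega))
      · rcases (show a = 3 ∨ 4 ≤ a by omega) with ha | ha
        · exact .inl (.alternate (by omega) (by omega) (by omega) (by omega))
        · exact .inl (.two_three_two ha (by omega) (by omega) (by omega))
    · obtain ⟨h₁, h₂⟩ := reducible_of_isRelation_eight ha hb hc hd ha' hb' hc' hd' hab hbc hcd hdd
        hcd' hbc' hab' haa r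
      rcases lt_or_gt_of_ne haa with hlt | hgt
      · exact .inr (h₂ hlt)
      · exact .inl (h₁ hgt)

/-! ### Rewriting reducible words with a smaller first letter -/

/-- Each reversal is replaced by its graph, a disjunction of linear conditions on intermediate
places, so that an identity with symbolic letters becomes linear arithmetic. -/
theorem wordMap_four_eq {a b c d e f g i : ℕ}
    (h : ∀ x y₁ y₂ y₃ y₄ z₁ z₂ z₃ z₄ : ℕ,
      (x < d ∧ y₁ + x + 1 = d) ∨ (d ≤ x ∧ y₁ = x) → (y₁ < c ∧ y₂ + y₁ + 1 = c) ∨ (c ≤ y₁ ∧ y₂ = y₁) →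
      (y₂ < b ∧ y₃ + y₂ + 1 = b) ∨ (b ≤ y₂ ∧ y₃ = y₂) → (y₃ < a ∧ y₄ + y₃ + 1 = a) ∨ (a ≤ y₃ ∧ y₄ = y₃) →
      (x < i ∧ z₁ + x + 1 = i) ∨ (i ≤ x ∧ z₁ = x) → (z₁ < g ∧ z₂ + z₁ + 1 = g) ∨ (g ≤ z₁ ∧ z₂ = z₁) →
      (z₂ < f ∧ z₃ + z₂ + 1 = f) ∨ (f ≤ z₂ ∧ z₃ = z₂) → (z₃ < e ∧ z₄ + z₃ + 1 = e) ∨ (e ≤ z₃ ∧ z₄ = z₃) →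
      y₄ = z₄) (x : ℕ) : wordMap [a, b, c, d] x = wordMap [e, f, g, i] x :=
  h x _ _ _ _ _ _ _ _ (natFlip_spec _ _) (natFlip_spec _ _) (natFlip_spec _ _) (natFlip_spec _ _)
    (natFlip_spec _ _) (natFlip_spec _ _) (natFlip_spec _ _) (natFlip_spec _ _)

-- Each family comes with an explicit substitute, read off from the relation behind it. Its letters
-- may be 1, where the reversal is the identity and the substitute is really a shorter word.
set_option maxHeartbeats 4000000 in
theorem exists_eq_of_reducible {n a b c d : ℕ} (ha : 2 ≤ a ∧ a ≤ n) (hb : 2 ≤ b ∧ b ≤ n)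
    (hc : 2 ≤ c ∧ c ≤ n) (hd : 2 ≤ d ∧ d ≤ n) (h : Reducible a b c d) :
    ∃ e f g i : ℕ, (1 ≤ e ∧ e ≤ n) ∧ (1 ≤ f ∧ f ≤ n) ∧ (1 ≤ g ∧ g ≤ n) ∧ (1 ≤ i ∧ i ≤ n) ∧ e < a ∧
      ∀ x, wordMap [a, b, c, d] x = wordMap [e, f, g, i] x := by
  obtain ⟨e, f, g, i, hb, h⟩ : ∃ e f g i : ℕ, ((1 ≤ e ∧ e ≤ n) ∧ (1 ≤ f ∧ f ≤ n) ∧ (1 ≤ g ∧ g ≤ n) ∧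
      (1 ≤ i ∧ i ≤ n) ∧ e < a) ∧ ∀ x y₁ y₂ y₃ y₄ z₁ z₂ z₃ z₄ : ℕ,
      (x < d ∧ y₁ + x + 1 = d) ∨ (d ≤ x ∧ y₁ = x) → (y₁ < c ∧ y₂ + y₁ + 1 = c) ∨ (c ≤ y₁ ∧ y₂ = y₁) →
      (y₂ < b ∧ y₃ + y₂ + 1 = b) ∨ (b ≤ y₂ ∧ y₃ = y₂) → (y₃ < a ∧ y₄ + y₃ + 1 = a) ∨ (a ≤ y₃ ∧ y₄ = y₃) →
      (x < i ∧ z₁ + x + 1 = i) ∨ (i ≤ x ∧ z₁ = x) → (z₁ < g ∧ z₂ + z₁ + 1 = g) ∨ (g ≤ z₁ ∧ z₂ = z₁) →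
      (z₂ < f ∧ z₃ + z₂ + 1 = f) ∨ (f ≤ z₂ ∧ z₃ = z₂) → (z₃ < e ∧ z₄ + z₃ + 1 = e) ∨ (e ≤ z₃ ∧ z₄ = z₃) →
      y₄ = z₄ := by
    rcases h with ⟨h₁, h₂, h₃⟩ |
      ⟨h₁, h₂, h₃⟩ |
      ⟨h₁, h₂, h₃, h₄⟩ |
      ⟨h₁, h₂, h₃⟩ |
      ⟨h₁, h₂, h₃⟩ |
      ⟨h₁, h₂, h₃⟩ |
      ⟨h₁, h₂, h₃⟩ |
      ⟨h₁, h₂⟩ |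
      ⟨h₁, h₂⟩ |
      ⟨h₁, h₂⟩ |
      ⟨h₁, h₂, h₃⟩ |
      ⟨h₁, h₂, h₃⟩ |
      ⟨h₁, h₂⟩ |
      ⟨h₁, h₂, h₃, h₄⟩ |
      ⟨h₁, h₂, h₃, h₄⟩ |
      ⟨h₁, h₂, h₃⟩ |
      ⟨h₁, h₂, h₃⟩ |
      ⟨h₁, h₂, h₃, h₄⟩ |
      ⟨h₁, h₂, h₃, h₄⟩
    -- The block b c b reverses the interval [b-c, b); moved past ρ_a it reverses [a-b, a-b+c), the
    -- last c of the first a-b+c places.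
    · refine ⟨a - b + c, c, a - b + c, a, by omega, fun x y₁ y₂ y₃ y₄ z₁ z₂ z₃ z₄ ↦ ?_⟩
      rintro (u | u) (u | u) (u | u) (u | u) <;> omega
    · refine ⟨d, a, b, c, by omega, fun x y₁ y₂ y₃ y₄ z₁ z₂ z₃ z₄ ↦ ?_⟩
      rintro (u | u) (u | u) (u | u) (u | u) <;> omega
    · rcases (show b + d ≤ a ∨ b + d = a + 1 ∨ b + 1 = a ∨ d + 1 = a by omega) with h | h | h | h
      -- The block a b a reverses the last b of the first a places, hence commutes with ρ_d when b +
      -- d ≤ a.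
      · refine ⟨d, a, b, a, by omega, fun x y₁ y₂ y₃ y₄ z₁ z₂ z₃ z₄ ↦ ?_⟩
        rintro (u | u) (u | u) (u | u) (u | u) <;> omega
      · refine ⟨d - 1, a - 1, b - 1, a, by omega, fun x y₁ y₂ y₃ y₄ z₁ z₂ z₃ z₄ ↦ ?_⟩
        rintro (u | u) (u | u) (u | u) (u | u) <;> omega
      · refine ⟨a + 1 - d, a - d, a, d - 1, by omega, fun x y₁ y₂ y₃ y₄ z₁ z₂ z₃ z₄ ↦ ?_⟩
        rintro (u | u) (u | u) (u | u) (u | u) <;> omega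
      · refine ⟨a - b, a - b + 1, a, b - 1, by omega, fun x y₁ y₂ y₃ y₄ z₁ z₂ z₃ z₄ ↦ ?_⟩
        rintro (u | u) (u | u) (u | u) (u | u) <;> omega
    · refine ⟨c - 1, b, b + 1 - c, b - c, by omega, fun x y₁ y₂ y₃ y₄ z₁ z₂ z₃ z₄ ↦ ?_⟩
      rintro (u | u) (u | u) (u | u) (u | u) <;> omega
    · refine ⟨a - b, a - b - 1, a, b + 1, by omega, fun x y₁ y₂ y₃ y₄ z₁ z₂ z₃ z₄ ↦ ?_⟩
      rintro (u | u) (u | u) (u | u) (u | u) <;> omega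
    · refine ⟨c + 1, a, a - 1 - c, a - c, by omega, fun x y₁ y₂ y₃ y₄ z₁ z₂ z₃ z₄ ↦ ?_⟩
      rintro (u | u) (u | u) (u | u) (u | u) <;> omega
    · refine ⟨a - 1, b, b - a, b + 1 - a, by omega, fun x y₁ y₂ y₃ y₄ z₁ z₂ z₃ z₄ ↦ ?_⟩
      rintro (u | u) (u | u) (u | u) (u | u) <;> omega
    -- The square of this word is trivial, so the word has the value of its own reversal.
    · refine ⟨d, c, b, a, by omega, fun x y₁ y₂ y₃ y₄ z₁ z₂ z₃ z₄ ↦ ?_⟩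
      rintro (u | u) (u | u) (u | u) (u | u) <;> omega
    · refine ⟨a - 1, b, c + 1, b, by omega, fun x y₁ y₂ y₃ y₄ z₁ z₂ z₃ z₄ ↦ ?_⟩
      rintro (u | u) (u | u) (u | u) (u | u) <;> omega
    · refine ⟨d - 1, c, b + 1, c, by omega, fun x y₁ y₂ y₃ y₄ z₁ z₂ z₃ z₄ ↦ ?_⟩
      rintro (u | u) (u | u) (u | u) (u | u) <;> omega
    · refine ⟨a - 1 - b, a - b, a, a - 1, by omega, fun x y₁ y₂ y₃ y₄ z₁ z₂ z₃ z₄ ↦ ?_⟩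
      rintro (u | u) (u | u) (u | u) (u | u) <;> omega
    · refine ⟨a - 1 - c, a - 1, a, a - c, by omega, fun x y₁ y₂ y₃ y₄ z₁ z₂ z₃ z₄ ↦ ?_⟩
      rintro (u | u) (u | u) (u | u) (u | u) <;> omega
    · refine ⟨d + 1, a, b + 1, a, by omega, fun x y₁ y₂ y₃ y₄ z₁ z₂ z₃ z₄ ↦ ?_⟩
      rintro (u | u) (u | u) (u | u) (u | u) <;> omega
    · refine ⟨2, 3, 2, d, by omega, fun x y₁ y₂ y₃ y₄ z₁ z₂ z₃ z₄ ↦ ?_⟩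
      rintro (u | u) (u | u) (u | u) (u | u) <;> omega
    · refine ⟨2, c, d, 2, by omega, fun x y₁ y₂ y₃ y₄ z₁ z₂ z₃ z₄ ↦ ?_⟩
      rintro (u | u) (u | u) (u | u) (u | u) <;> omega
    · refine ⟨1, c, 2, c, by omega, fun x y₁ y₂ y₃ y₄ z₁ z₂ z₃ z₄ ↦ ?_⟩
      rintro (u | u) (u | u) (u | u) (u | u) <;> omega
    · refine ⟨1, b - 1, b, b - 1, by omega, fun x y₁ y₂ y₃ y₄ z₁ z₂ z₃ z₄ ↦ ?_⟩
      rintro (u | u) (u | u) (u | u) (u | u) <;> omega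
    · refine ⟨2, a, b, 2, by omega, fun x y₁ y₂ y₃ y₄ z₁ z₂ z₃ z₄ ↦ ?_⟩
      rintro (u | u) (u | u) (u | u) (u | u) <;> omega
    · refine ⟨a - 1, 2, a - 1, a, by omega, fun x y₁ y₂ y₃ y₄ z₁ z₂ z₃ z₄ ↦ ?_⟩
      rintro (u | u) (u | u) (u | u) (u | u) <;> omega
  exact ⟨e, f, g, i, hb.1, hb.2.1, hb.2.2.1, hb.2.2.2.1, hb.2.2.2.2, wordMap_four_eq h⟩

/-! ### From words to permutations at distance four -/

theorem coe_flip {n i : ℕ} (hi : i ≤ n) (j : Fin n) : (flip i hi j : ℕ) = natFlip i j := rfl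

theorem wordMap_eq_self {n x : ℕ} {l : List ℕ} (hl : ∀ a ∈ l, a ≤ n) (hx : n ≤ x) :
    wordMap l x = x :=
  wordMap_of_le (fun a ha ↦ (hl a ha).trans hx) rfl

theorem exists_letters {n : ℕ} (w : List (Equiv.Perm (Fin n))) (hw : ∀ r ∈ w, r ∈ flips n) :
    ∃ l : List ℕ, l.length = w.length ∧ (∀ a ∈ l, 2 ≤ a ∧ a ≤ n) ∧
      ∀ j : Fin n, (w.prod j : ℕ) = wordMap l j := by
  induction w with
  | nil => exact ⟨[], rfl, by simp, fun j ↦ rfl⟩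
  | cons r w ih =>
    obtain ⟨l, hl, hl', h⟩ := ih fun r hr ↦ hw r (by simp [hr])
    obtain ⟨i, hi, hi2, rfl⟩ := hw r (by simp)
    refine ⟨i :: l, by simp [hl], by simpa using ⟨⟨hi2, hi⟩, fun a ha ↦ hl' a ha⟩, fun j ↦ ?_⟩
    rw [List.prod_cons, Equiv.Perm.mul_apply, coe_flip, h, wordMap_cons]

theorem exists_flips {n : ℕ} (l : List ℕ) (hl : ∀ a ∈ l, 2 ≤ a ∧ a ≤ n) :
    ∃ w : List (Equiv.Perm (Fin n)), w.length = l.length ∧ (∀ r ∈ w, r ∈ flips n) ∧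
      ∀ j : Fin n, (w.prod j : ℕ) = wordMap l j := by
  induction l with
  | nil => exact ⟨[], rfl, by simp, fun j ↦ rfl⟩
  | cons a l ih =>
    obtain ⟨w, hw, hw', h⟩ := ih fun b hb ↦ hl b (by simp [hb])
    have ha := hl a (by simp)
    refine ⟨flip a ha.2 :: w, by simp [hw], ?_, fun j ↦ ?_⟩
    · simpa using ⟨⟨a, ha.2, ha.1, rfl⟩, hw'⟩
    · rw [List.prod_cons, Equiv.Perm.mul_apply, coe_flip, h, wordMap_cons]

theorem reaches_one_iff {n m : ℕ} {π : Equiv.Perm (Fin n)} :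
    Reaches 1 π m ↔ ∃ l : List ℕ, l.length = m ∧ (∀ a ∈ l, 2 ≤ a ∧ a ≤ n) ∧
      ∀ j : Fin n, (π j : ℕ) = wordMap l j := by
  constructor
  · rintro ⟨w, rfl, hw, rfl⟩
    simpa using exists_letters w hw
  · rintro ⟨l, rfl, hl, h⟩
    obtain ⟨w, hw, hw', h'⟩ := exists_flips l hl
    refine ⟨w, hw, hw', Equiv.ext fun j ↦ Fin.ext ?_⟩
    rw [h, one_mul, h']

/-- Removing the trivial letters from a word. -/
theorem exists_shorter_of_one_mem {n : ℕ} {l : List ℕ} (hl : ∀ a ∈ l, 1 ≤ a ∧ a ≤ n) (h1 : 1 ∈ l) :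
    ∃ l' : List ℕ, l'.length < l.length ∧ (∀ a ∈ l', 2 ≤ a ∧ a ≤ n) ∧
      ∀ x, wordMap l x = wordMap l' x := by
  have key : ∀ l : List ℕ, ∀ x, wordMap l x = wordMap (l.filter (· ≠ 1)) x := by
    intro l
    induction l with
    | nil => exact fun x ↦ rfl
    | cons a l ih =>
      intro x
      rcases eq_or_ne a 1 with rfl | ha
      · have := natFlip_spec 1 (wordMap (l.filter (· ≠ 1)) x)
        simp only [wordMap_cons, ih x]
        rw [List.filter_cons_of_neg (by simp)]
        omega
      · rw [List.filter_cons_of_pos (by simpa using ha), wordMap_cons, wordMap_cons, ih]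
  refine ⟨l.filter (· ≠ 1), ?_, fun a ha ↦ ?_, key l⟩
  · refine lt_of_le_of_ne (List.length_filter_le _ _) fun h ↦ ?_
    have := List.length_filter_eq_length_iff.1 h 1 h1
    simp at this
  · rw [List.mem_filter] at ha
    have := hl a ha.1
    have h2 : a ≠ 1 := by simpa using ha.2
    omega

/-- Forwards, a word with the least possible first letter is chosen: equal neighbours or a letter 1
would shorten it, and a reducible word has a substitute that is shorter or starts lower. Backwards,
`reducible_of_shorter` rules out shorter words. -/
theorem distEq_four_iff {n : ℕ} {π : Equiv.Perm (Fin n)} :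
    DistEq 1 π 4 ↔ ∃ a b c d : ℕ, (∀ x ∈ [a, b, c, d], 2 ≤ x ∧ x ≤ n) ∧ a ≠ b ∧ b ≠ c ∧ c ≠ d ∧
      ¬ Reducible a b c d ∧ ∀ j : Fin n, (π j : ℕ) = wordMap [a, b, c, d] j := by
  have ext : ∀ {l l' : List ℕ}, (∀ x ∈ l, 2 ≤ x ∧ x ≤ n) → (∀ x ∈ l', 2 ≤ x ∧ x ≤ n) →
      (∀ j : Fin n, (π j : ℕ) = wordMap l j) → (∀ j : Fin n, (π j : ℕ) = wordMap l' j) →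
      ∀ x, wordMap l x = wordMap l' x := by
    intro l l' hl hl' h h' x
    rcases lt_or_ge x n with hx | hx
    · exact (h ⟨x, hx⟩).symm.trans (h' ⟨x, hx⟩)
    · rw [wordMap_eq_self (fun a ha ↦ (hl a ha).2) hx, wordMap_eq_self (fun a ha ↦ (hl' a ha).2) hx]
  constructor
  · rintro ⟨h4, hmin⟩
    have short : ∀ l : List ℕ, (∀ a ∈ l, 2 ≤ a ∧ a ≤ n) → (∀ j : Fin n, (π j : ℕ) = wordMap l j) →
        4 ≤ l.length := fun l hl h ↦ hmin (reaches_one_iff.2 ⟨l, rfl, hl, h⟩)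
    have hex : ∃ a b c d : ℕ, (∀ x ∈ [a, b, c, d], 2 ≤ x ∧ x ≤ n) ∧
        ∀ j : Fin n, (π j : ℕ) = wordMap [a, b, c, d] j := by
      obtain ⟨l, hl, hl', h⟩ := reaches_one_iff.1 h4
      match l, hl with
      | [a, b, c, d], _ => exact ⟨a, b, c, d, hl', h⟩
    classical
    -- Only the first letter is minimised; any completion b, c, d will do.
    have hfind := Nat.find_spec hex
    have hleast := fun k ↦ Nat.find_min hex (m := k)
    generalize Nat.find hex = a at hfind hleast
    obtain ⟨b, c, d, hl, h⟩ := hfind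
    refine ⟨a, b, c, d, hl, ?_, ?_, ?_, ?_, h⟩
    · rintro rfl
      have := short [c, d] (fun x hx ↦ hl x (by simp at hx ⊢; tauto))
        (by simpa [natFlip_natFlip] using h)
      simp at this
    · rintro rfl
      have := short [a, d] (fun x hx ↦ hl x (by simp at hx ⊢; tauto))
        (by simpa [natFlip_natFlip] using h)
      simp at this
    · rintro rfl
      have := short [a, b] (fun x hx ↦ hl x (by simp at hx ⊢; tauto))
        (by simpa [natFlip_natFlip] using h)
      simp at this
    · intro hr
      obtain ⟨e, f, g, i, he, hf, hg, hi, hea, heq⟩ := exists_eq_of_reducible (hl a (by simp))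
        (hl b (by simp)) (hl c (by simp)) (hl d (by simp)) hr
      have hone : ∀ x ∈ [e, f, g, i], 1 ≤ x ∧ x ≤ n := by simp [he, hf, hg, hi]
      by_cases h1 : 1 ∈ [e, f, g, i]
      · obtain ⟨l', hlen, hl', heq'⟩ := exists_shorter_of_one_mem hone h1
        have := short l' hl' fun j ↦ by rw [h, heq, heq']
        simp at hlen
        omega
      · refine hleast e hea ⟨f, g, i, fun x hx ↦ ?_, fun j ↦ by rw [h, heq]⟩
        have := hone x hx
        have : x ≠ 1 := by rintro rfl; exact h1 hx
        omega
  · rintro ⟨a, b, c, d, hl, hab, hbc, hcd, hr, h⟩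
    refine ⟨reaches_one_iff.2 ⟨_, rfl, hl, h⟩, fun m hm ↦ ?_⟩
    obtain ⟨l', rfl, hl', h'⟩ := reaches_one_iff.1 hm
    by_contra! hlen
    exact hr (reducible_of_shorter (hl a (by simp)).1 (hl b (by simp)).1 (hl c (by simp)).1
      (hl d (by simp)).1 hab hbc hcd (fun x hx ↦ (hl' x hx).1) hlen (ext hl hl' h h'))

/-- The words of length four over `{2, …, n}`. -/
def words (n : ℕ) : Finset (ℕ × ℕ × ℕ × ℕ) :=
  Finset.Icc 2 n ×ˢ Finset.Icc 2 n ×ˢ Finset.Icc 2 n ×ˢ Finset.Icc 2 n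

theorem mem_words {n a b c d : ℕ} : (a, b, c, d) ∈ words n ↔
    (2 ≤ a ∧ a ≤ n) ∧ (2 ≤ b ∧ b ≤ n) ∧ (2 ≤ c ∧ c ≤ n) ∧ 2 ≤ d ∧ d ≤ n := by
  simp [words]

/-- Consecutive letters of the word are distinct. -/
def IsReduced (w : ℕ × ℕ × ℕ × ℕ) : Prop := w.1 ≠ w.2.1 ∧ w.2.1 ≠ w.2.2.1 ∧ w.2.2.1 ≠ w.2.2.2

-- Evaluation maps the irreducible reduced words onto the permutations at distance four by
-- `distEq_four_iff`, and injectively by `reducible_of_wordMap_eq`.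
open Classical in
theorem numAtDist_four (n : ℕ) : numAtDist 4 n =
    ((words n).filter fun w ↦ IsReduced w ∧ ¬ Reducible w.1 w.2.1 w.2.2.1 w.2.2.2).card := by
  have hex : ∀ w : ℕ × ℕ × ℕ × ℕ, ∃ π : Equiv.Perm (Fin n), w ∈ words n →
      ∀ j : Fin n, (π j : ℕ) = wordMap [w.1, w.2.1, w.2.2.1, w.2.2.2] j := by
    rintro ⟨a, b, c, d⟩
    by_cases hw : (a, b, c, d) ∈ words n
    · obtain ⟨w, -, -, h⟩ := exists_flips (n := n) [a, b, c, d] (by simpa [words] using hw)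
      exact ⟨w.prod, fun _ ↦ h⟩
    · exact ⟨1, fun h ↦ absurd h hw⟩
  choose F hF using hex
  rw [numAtDist, ← Set.ncard_coe_finset, ← Set.InjOn.ncard_image (f := F)]
  · congr 1
    ext π
    simp only [Set.mem_ofPred_eq, distEq_four_iff, Set.mem_image, Finset.mem_coe, Finset.mem_filter]
    constructor
    · rintro ⟨a, b, c, d, hl, hab, hbc, hcd, hr, h⟩
      have hw : (a, b, c, d) ∈ words n := by simpa [words] using hl
      refine ⟨(a, b, c, d), ⟨hw, ⟨hab, hbc, hcd⟩, hr⟩, Equiv.ext fun j ↦ Fin.ext ?_⟩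
      rw [hF _ hw, h]
    · rintro ⟨⟨a, b, c, d⟩, ⟨hw, ⟨hab, hbc, hcd⟩, hr⟩, rfl⟩
      exact ⟨a, b, c, d, by simpa [words] using hw, hab, hbc, hcd, hr, hF _ hw⟩
  · rintro ⟨a, b, c, d⟩ h ⟨a', b', c', d'⟩ h' heq
    simp only [Finset.coe_filter, Set.mem_ofPred_eq] at h h'
    obtain ⟨hw, ⟨hab, hbc, hcd⟩, hr⟩ := h
    obtain ⟨hw', ⟨hab', hbc', hcd'⟩, hr'⟩ := h'
    have e : ∀ x, wordMap [a, b, c, d] x = wordMap [a', b', c', d'] x := by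
      intro x
      rcases lt_or_ge x n with hx | hx
      · have h₁ := hF _ hw ⟨x, hx⟩
        have h₂ := hF _ hw' ⟨x, hx⟩
        rw [heq] at h₁
        exact h₁.symm.trans h₂
      · rw [mem_words] at hw hw'
        rw [wordMap_eq_self (n := n) (by simp; omega) hx,
          wordMap_eq_self (n := n) (by simp; omega) hx]
    rw [mem_words] at hw hw'
    by_contra hne
    rcases reducible_of_wordMap_eq hw.1.1 hw.2.1.1 hw.2.2.1.1 hw.2.2.2.1 hw'.1.1 hw'.2.1.1
      hw'.2.2.1.1 hw'.2.2.2.1 hab hbc hcd hab' hbc' hcd' e hne with h | h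
    · exact hr h
    · exact hr' h

/-! ### Counting reduced and reducible words -/

open Finset

/-- The pairs `(m, s)` with `m ≤ n`, `p ≤ s` and `s + q ≤ m`. -/
def triangle (n p q : ℕ) : Finset (ℕ × ℕ) :=
  (range (n + 1) ×ˢ range (n + 1)).filter fun x ↦ p ≤ x.2 ∧ x.2 + q ≤ x.1

theorem mem_triangle {n p q m s : ℕ} : (m, s) ∈ triangle n p q ↔ m ≤ n ∧ p ≤ s ∧ s + q ≤ m := by
  simp only [triangle, mem_filter, mem_product, mem_range]
  omega

theorem card_triangle {n p q : ℕ} (hp : 1 ≤ p) (h : p + q ≤ n + 1) :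
    ((triangle n p q).card : ℚ) = ((n : ℚ) + 1 - p - q) * (n + 2 - p - q) / 2 := by
  obtain ⟨k, hk⟩ := Nat.exists_eq_add_of_le h
  induction k generalizing n with
  | zero =>
    have : triangle n p q = ∅ := by
      ext ⟨m, s⟩
      rw [mem_triangle]
      simp
      omega
    rw [this]
    have : (n : ℚ) + 1 = p + q := by exact_mod_cast hk
    rw [this]
    simp
  | succ k ih =>
    obtain ⟨n, rfl⟩ : ∃ l, n = l + 1 := ⟨p + q + k - 1 , by omega⟩
    have e : triangle (n + 1) p q =
        (triangle n p q).disjUnion ((Icc p (n + 1 - q)).image fun s ↦ (n + 1, s)) (by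
          rw [disjoint_left]
          rintro ⟨m, s⟩ h₁ h₂
          rw [mem_triangle] at h₁
          simp at h₂
          omega) := by
      ext ⟨m, s⟩
      simp only [mem_disjUnion, mem_triangle, mem_image, mem_Icc, Prod.mk.injEq]
      constructor
      · intro h'
        rcases (show m ≤ n ∨ n + 1 = m by omega) with hm | hm
        · left; omega
        · exact .inr ⟨s, by omega, hm, rfl⟩
      · rintro (h' | ⟨s, h', rfl, rfl⟩) <;> omega
    have hk' : (n : ℚ) + 1 = p + q + k := by exact_mod_cast (show n + 1 = p + q + k by omega)
    have hn : n + 1 - q + 1 - p = k + 1 := by omega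
    rw [e, card_disjUnion, card_image_of_injective _ (fun s t h ↦ by simpa using h), Nat.card_Icc,
      hn]
    push_cast
    rw [ih (by omega) (by omega)]
    have : (n : ℚ) = p + q + k - 1 := by linarith
    rw [this]
    ring

/-- The triples `(m, u, s)` with `m ≤ n`, `u ≤ m + q`, `2 ≤ s` and `s + 2 ≤ u`. -/
def tetrahedron (n q : ℕ) : Finset (Σ _ : ℕ, ℕ × ℕ) :=
  (Icc 3 n).sigma fun m ↦ triangle (m + q) 2 2

theorem mem_tetrahedron {n q m u s : ℕ} : (⟨m, u, s⟩ : Σ _ : ℕ, ℕ × ℕ) ∈ tetrahedron n q ↔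
    (3 ≤ m ∧ m ≤ n) ∧ u ≤ m + q ∧ 2 ≤ s ∧ s + 2 ≤ u := by
  rw [tetrahedron, mem_sigma, mem_Icc, mem_triangle]

/-- Summing the triangle counts gives a hockey-stick difference, C(n+q-1, 3) - C(q+1, 3). -/
theorem card_tetrahedron {n q : ℕ} (h : 2 ≤ n) :
    ((tetrahedron n q).card : ℚ) =
      ((n + q - 1) * (n + q - 2) * (n + q - 3) - (q + 1) * q * (q - 1)) / 6 := by
  induction n, h using Nat.le_induction with
  | base => simp [tetrahedron]; ring
  | succ n hn ih =>
    have : (tetrahedron (n + 1) q).card = (tetrahedron n q).card +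
        (triangle (n + 1 + q) 2 2).card := by
      rw [tetrahedron, card_sigma, tetrahedron, card_sigma, Finset.sum_Icc_succ_top (by omega)]
    rw [this]
    push_cast
    rw [ih, card_triangle (by omega) (by omega)]
    push_cast
    ring

theorem card_isReduced {n : ℕ} [DecidablePred IsReduced] (h : 2 ≤ n) :
    (((words n).filter IsReduced).card : ℚ) = (n - 1) * (n - 2) ^ 3 := by
  have e : ((words n).filter IsReduced).card = ((Icc 2 n).sigma fun a ↦ ((Icc 2 n).erase a).sigma
      fun b ↦ ((Icc 2 n).erase b).sigma fun c ↦ (Icc 2 n).erase c).card := by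
    refine card_nbij' (fun w ↦ ⟨w.1, w.2.1, w.2.2.1, w.2.2.2⟩)
      (fun x ↦ (x.1, x.2.1, x.2.2.1, x.2.2.2)) ?_ ?_ (fun _ _ ↦ rfl) (fun _ _ ↦ rfl)
    · rintro ⟨a, b, c, d⟩ h
      simp only [coe_filter, Set.mem_ofPred_eq, mem_words, IsReduced] at h
      simp only [mem_coe, mem_sigma, mem_erase, mem_Icc]
      tauto
    · rintro ⟨a, b, c, d⟩ h
      simp only [mem_coe, mem_sigma, mem_erase, mem_Icc] at h
      simp only [coe_filter, Set.mem_ofPred_eq, mem_words, IsReduced]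
      tauto
  have c : ∀ a ∈ Icc 2 n, ((Icc 2 n).erase a).card = n - 2 := by
    intro a ha
    rw [card_erase_of_mem ha, Nat.card_Icc]
    omega
  have m : ∀ a b, b ∈ (Icc 2 n).erase a → b ∈ Icc 2 n := fun a b hb ↦ mem_of_mem_erase hb
  rw [e, card_sigma, sum_congr rfl (g := fun _ ↦ (n - 2) * ((n - 2) * (n - 2)))]
  · rw [sum_const, Nat.card_Icc, smul_eq_mul]
    obtain ⟨k, rfl⟩ := Nat.exists_eq_add_of_le h
    rw [show 2 + k + 1 - 2 = k + 1 by omega, show 2 + k - 2 = k by omega]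
    push_cast
    ring
  · intro a ha
    rw [card_sigma, sum_congr rfl (g := fun _ ↦ (n - 2) * (n - 2)), sum_const, c a ha, smul_eq_mul]
    intro b hb
    rw [card_sigma, sum_congr rfl (g := fun _ ↦ n - 2), sum_const, c b (m a b hb), smul_eq_mul]
    exact fun d hd ↦ c d (m b d hd)

open Classical in
/-- The words over `{2, …, n}` with a given property. -/
noncomputable def wordsWith (n : ℕ) (P : ℕ → ℕ → ℕ → ℕ → Prop) : Finset (ℕ × ℕ × ℕ × ℕ) :=
  (words n).filter fun w ↦ P w.1 w.2.1 w.2.2.1 w.2.2.2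

theorem mem_wordsWith {n : ℕ} {P : ℕ → ℕ → ℕ → ℕ → Prop} {a b c d : ℕ} :
    (a, b, c, d) ∈ wordsWith n P ↔
      ((2 ≤ a ∧ a ≤ n) ∧ (2 ≤ b ∧ b ≤ n) ∧ (2 ≤ c ∧ c ≤ n) ∧ 2 ≤ d ∧ d ≤ n) ∧ P a b c d := by
  simp only [wordsWith, mem_filter, mem_words]

theorem card_wordsWith_or {n : ℕ} {P Q : ℕ → ℕ → ℕ → ℕ → Prop}
    (h : ∀ a b c d, 2 ≤ a → 2 ≤ b → 2 ≤ c → 2 ≤ d → P a b c d → ¬ Q a b c d) :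
    (wordsWith n fun a b c d ↦ P a b c d ∨ Q a b c d).card =
      (wordsWith n P).card + (wordsWith n Q).card := by
  rw [← card_union_of_disjoint]
  · congr 1
    ext ⟨a, b, c, d⟩
    rw [mem_union, mem_wordsWith, mem_wordsWith, mem_wordsWith, and_or_left]
  · rw [disjoint_left]
    rintro ⟨a, b, c, d⟩ h₁ h₂
    rw [mem_wordsWith] at h₁ h₂
    exact h a b c d h₁.1.1.1 h₁.1.2.1.1 h₁.1.2.2.1.1 h₁.1.2.2.2.1 h₁.2 h₂.2

theorem card_wordsWith_eq_triangle {n p q : ℕ} {P : ℕ → ℕ → ℕ → ℕ → Prop}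
    (f : ℕ × ℕ → ℕ × ℕ × ℕ × ℕ) (g : ℕ × ℕ × ℕ × ℕ → ℕ × ℕ)
    (hf : ∀ m s, m ≤ n ∧ p ≤ s ∧ s + q ≤ m → f (m, s) ∈ wordsWith n P ∧ g (f (m, s)) = (m, s))
    (hg : ∀ a b c d, (a, b, c, d) ∈ wordsWith n P →
      g (a, b, c, d) ∈ triangle n p q ∧ f (g (a, b, c, d)) = (a, b, c, d)) :
    (wordsWith n P).card = (triangle n p q).card :=
  card_nbij' g f (fun _ hw ↦ (hg _ _ _ _ hw).1) (fun _ hx ↦ (hf _ _ (mem_triangle.1 hx)).1)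
    (fun _ hw ↦ (hg _ _ _ _ hw).2) (fun _ hx ↦ (hf _ _ (mem_triangle.1 hx)).2)

theorem card_wordsWith_eq_tetrahedron {n q : ℕ} {P : ℕ → ℕ → ℕ → ℕ → Prop}
    (f : ℕ → ℕ → ℕ → ℕ × ℕ × ℕ × ℕ) (g : ℕ × ℕ × ℕ × ℕ → Σ _ : ℕ, ℕ × ℕ)
    (hf : ∀ m u s, (3 ≤ m ∧ m ≤ n) ∧ u ≤ m + q ∧ 2 ≤ s ∧ s + 2 ≤ u →
      f m u s ∈ wordsWith n P ∧ g (f m u s) = ⟨m, u, s⟩)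
    (hg : ∀ a b c d, (a, b, c, d) ∈ wordsWith n P → g (a, b, c, d) ∈ tetrahedron n q ∧
      f (g (a, b, c, d)).1 (g (a, b, c, d)).2.1 (g (a, b, c, d)).2.2 = (a, b, c, d)) :
    (wordsWith n P).card = (tetrahedron n q).card :=
  card_nbij' g (fun x ↦ f x.1 x.2.1 x.2.2) (fun _ hw ↦ (hg _ _ _ _ hw).1)
    (fun _ hx ↦ (hf _ _ _ (mem_tetrahedron.1 hx)).1) (fun _ hw ↦ (hg _ _ _ _ hw).2)
    (fun _ hx ↦ (hf _ _ _ (mem_tetrahedron.1 hx)).2)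

theorem card_wordsWith_eq_Icc {n p : ℕ} {P : ℕ → ℕ → ℕ → ℕ → Prop}
    (f : ℕ → ℕ × ℕ × ℕ × ℕ) (g : ℕ × ℕ × ℕ × ℕ → ℕ)
    (hf : ∀ m, p ≤ m ∧ m ≤ n → f m ∈ wordsWith n P ∧ g (f m) = m)
    (hg : ∀ a b c d, (a, b, c, d) ∈ wordsWith n P →
      g (a, b, c, d) ∈ Icc p n ∧ f (g (a, b, c, d)) = (a, b, c, d)) :
    (wordsWith n P).card = (Icc p n).card :=
  card_nbij' g f (fun _ hw ↦ (hg _ _ _ _ hw).1) (fun _ hx ↦ (hf _ (mem_Icc.1 hx)).1)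
    (fun _ hw ↦ (hg _ _ _ _ hw).2) (fun _ hx ↦ (hf _ (mem_Icc.1 hx)).2)

/-- The bounds in the families of `Reducible` are chosen so that, for letters at least 2, the
families are pairwise disjoint and their sizes add. Three of the pieces have three free parameters
(tetrahedra), twelve have two (triangles) and six have one (intervals). -/
theorem card_reducible {n : ℕ} (h : 4 ≤ n) : ((wordsWith n Reducible).card : ℚ) =
    (n - 1) * (n - 2) * (n - 3) / 6 * 2 + n * (n - 1) * (n - 2) / 6 + (n - 1) * (n - 2) / 2 +
      (n - 2) * (n - 3) / 2 * 7 + (n - 3) * (n - 4) / 2 * 4 + (n - 3) * 5 + (n - 4) := by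
  -- Only `alternate` has overlapping alternatives. It is cut into three disjoint pieces; the bounds
  -- 3 ≤ d and 3 ≤ b exclude what b + d ≤ a + 1 already covers.
  have e : wordsWith n Reducible = wordsWith n fun a b c d ↦
      (b = d ∧ c < b ∧ b < a) ∨
      (a + c = b + d ∧ d < c ∧ c < b) ∨
      (a = c ∧ b < a ∧ d < a ∧ b + d ≤ a + 1) ∨
      (a = c ∧ b + 1 = a ∧ 3 ≤ d ∧ d < a) ∨
      (a = c ∧ d + 1 = a ∧ 3 ≤ b ∧ b + 1 < a) ∨
      (b = d ∧ a + 1 = b ∧ c < b) ∨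
      (a = d ∧ c + 1 = a ∧ b + 2 ≤ a) ∨
      (a = d ∧ b + 1 = a ∧ c + 2 ≤ a) ∨
      (b = d ∧ c + 1 = b ∧ a + 2 ≤ b) ∨
      (c + 1 = a ∧ b + d = a) ∨
      (d + 1 = b ∧ a + c = b) ∨
      (a + 1 = c ∧ b + d = c) ∨
      (a = d ∧ c = b + 1 ∧ b + 3 ≤ a) ∨
      (a = d ∧ b = c + 1 ∧ c + 3 ≤ a) ∨
      (c + 1 = a ∧ b + d + 1 = a) ∨
      (a = 3 ∧ b = 2 ∧ c = 3 ∧ 4 ≤ d) ∨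
      (a = 3 ∧ b = 2 ∧ d + 1 = c ∧ 4 ≤ c) ∨
      (a + 1 = b ∧ b = d ∧ c = b + 1) ∨
      (a + 2 = b ∧ b = d ∧ c = 2) ∨
      (b = a + 1 ∧ c = 2 ∧ d = 3 ∧ 4 ≤ b) ∨
      (b = 2 ∧ c = 3 ∧ d = 2 ∧ 5 ≤ a) := by
    ext ⟨a, b, c, d⟩
    rw [mem_wordsWith, mem_wordsWith]
    refine and_congr_right fun hw ↦ ⟨fun h ↦ ?_, fun h ↦ ?_⟩
    · rcases h with ⟨h₁, h₂, h₃⟩ |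
        ⟨h₁, h₂, h₃⟩ |
        ⟨h₁, h₂, h₃, h₄⟩ |
        ⟨h₁, h₂, h₃⟩ |
        ⟨h₁, h₂, h₃⟩ |
        ⟨h₁, h₂, h₃⟩ |
        ⟨h₁, h₂, h₃⟩ |
        ⟨h₁, h₂⟩ |
        ⟨h₁, h₂⟩ |
        ⟨h₁, h₂⟩ |
        ⟨h₁, h₂, h₃⟩ |
        ⟨h₁, h₂, h₃⟩ |
        ⟨h₁, h₂⟩ |
        ⟨h₁, h₂, h₃, h₄⟩ |
        ⟨h₁, h₂, h₃, h₄⟩ |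
        ⟨h₁, h₂, h₃⟩ |
        ⟨h₁, h₂, h₃⟩ |
        ⟨h₁, h₂, h₃, h₄⟩ |
        ⟨h₁, h₂, h₃, h₄⟩
      · exact .inl (by omega)
      · iterate 1 apply Or.inr
        exact .inl (by omega)
      · rcases (show b + d ≤ a + 1 ∨ (b + 1 = a ∧ 3 ≤ d) ∨ (d + 1 = a ∧ 3 ≤ b ∧ b + 1 < a) by omega)
          with h | h | h
        · iterate 2 apply Or.inr
          exact .inl (by omega)
        · iterate 3 apply Or.inr
          exact .inl (by omega)
        · iterate 4 apply Or.inr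
          exact .inl (by omega)
      · iterate 5 apply Or.inr
        exact .inl (by omega)
      · iterate 6 apply Or.inr
        exact .inl (by omega)
      · iterate 7 apply Or.inr
        exact .inl (by omega)
      · iterate 8 apply Or.inr
        exact .inl (by omega)
      · iterate 9 apply Or.inr
        exact .inl (by omega)
      · iterate 10 apply Or.inr
        exact .inl (by omega)
      · iterate 11 apply Or.inr
        exact .inl (by omega)
      · iterate 12 apply Or.inr
        exact .inl (by omega)
      · iterate 13 apply Or.inr
        exact .inl (by omega)
      · iterate 14 apply Or.inr
        exact .inl (by omega)
      · iterate 15 apply Or.inr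
        exact .inl (by omega)
      · iterate 16 apply Or.inr
        exact .inl (by omega)
      · iterate 17 apply Or.inr
        exact .inl (by omega)
      · iterate 18 apply Or.inr
        exact .inl (by omega)
      · iterate 19 apply Or.inr
        exact .inl (by omega)
      · iterate 20 apply Or.inr
        omega
    · rcases h with h | h | h | h | h | h | h | h | h | h | h | h | h | h | h | h | h | h | h | h | h
      · exact .nest (by omega) (by omega) (by omega)
      · exact .slide (by omega) (by omega) (by omega)
      · exact .alternate (by omega) (by omega) (by omega) (by omega)
      · exact .alternate (by omega) (by omega) (by omega) (by omega)
      · exact .alternate (by omega) (by omega) (by omega) (by omega)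
      · exact .ascend_nest (by omega) (by omega) (by omega)
      · exact .wrap_third (by omega) (by omega) (by omega)
      · exact .wrap_second (by omega) (by omega) (by omega)
      · exact .nest_pred (by omega) (by omega) (by omega)
      · exact .split_outer (by omega) (by omega)
      · exact .split_inner (by omega) (by omega)
      · exact .split_succ (by omega) (by omega)
      · exact .wrap_ascend (by omega) (by omega) (by omega)
      · exact .wrap_descend (by omega) (by omega) (by omega)
      · exact .split_pred (by omega) (by omega)
      · exact .three_two_three (by omega) (by omega) (by omega) (by omega)
      · exact .three_two_pred (by omega) (by omega) (by omega) (by omega)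
      · exact .ascend_zigzag (by omega) (by omega) (by omega)
      · exact .jump_two (by omega) (by omega) (by omega)
      · exact .ascend_two_three (by omega) (by omega) (by omega) (by omega)
      · exact .head_two_three_two (by omega) (by omega) (by omega) (by omega)
  have c0 : (wordsWith n fun a b c d ↦ b = d ∧ c < b ∧ b < a).card =
      (tetrahedron n 0).card := card_wordsWith_eq_tetrahedron (fun m u s ↦ (m, u - 1, s, u - 1))
    (fun w ↦ ⟨w.1, w.2.1 + 1, w.2.2.1⟩)
    (fun m u s _ ↦ by
      simp only [mem_wordsWith, Sigma.mk.injEq, heq_eq_eq, Prod.mk.injEq, true_and, and_true]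
      omega)
    (fun a b c d hw ↦ by
      simp only [mem_wordsWith] at hw
      simp only [mem_tetrahedron, Prod.mk.injEq, true_and, and_true]
      omega)
  have c1 : (wordsWith n fun a b c d ↦ a + c = b + d ∧ d < c ∧ c < b).card =
      (tetrahedron n 0).card := card_wordsWith_eq_tetrahedron (fun m u s ↦ (m + s + 1 - u, m, u - 1, s))
    (fun w ↦ ⟨w.2.1, w.2.2.1 + 1, w.2.2.2⟩)
    (fun m u s _ ↦ by
      simp only [mem_wordsWith, Sigma.mk.injEq, heq_eq_eq, Prod.mk.injEq, true_and, and_true]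
      omega)
    (fun a b c d hw ↦ by
      simp only [mem_wordsWith] at hw
      simp only [mem_tetrahedron, Prod.mk.injEq, true_and, and_true]
      omega)
  -- The middle coordinate is the sum b + d, which may reach a + 1; hence the tetrahedron with
  -- offset 1.
  have c2 : (wordsWith n fun a b c d ↦ a = c ∧ b < a ∧ d < a ∧ b + d ≤ a + 1).card =
      (tetrahedron n 1).card := card_wordsWith_eq_tetrahedron (fun m u s ↦ (m, s, m, u - s))
    (fun w ↦ ⟨w.1, w.2.1 + w.2.2.2, w.2.1⟩)
    (fun m u s _ ↦ by
      simp only [mem_wordsWith, Sigma.mk.injEq, heq_eq_eq, Prod.mk.injEq, true_and, and_true]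
      omega)
    (fun a b c d hw ↦ by
      simp only [mem_wordsWith] at hw
      simp only [mem_tetrahedron, Prod.mk.injEq, true_and, and_true]
      omega)
  have c3 : (wordsWith n fun a b c d ↦ a = c ∧ b + 1 = a ∧ 3 ≤ d ∧ d < a).card =
      (triangle n 3 1).card := card_wordsWith_eq_triangle (fun x ↦ (x.1, x.1 - 1, x.1, x.2))
    (fun w ↦ (w.1, w.2.2.2))
    (fun m s _ ↦ by simp only [mem_wordsWith, Prod.mk.injEq, true_and, and_true]; omega)
    (fun a b c d hw ↦ by
      simp only [mem_wordsWith] at hw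
      simp only [mem_triangle, Prod.mk.injEq, true_and, and_true]
      omega)
  have c4 : (wordsWith n fun a b c d ↦ a = c ∧ d + 1 = a ∧ 3 ≤ b ∧ b + 1 < a).card =
      (triangle n 3 2).card := card_wordsWith_eq_triangle (fun x ↦ (x.1, x.2, x.1, x.1 - 1))
    (fun w ↦ (w.1, w.2.1))
    (fun m s _ ↦ by simp only [mem_wordsWith, Prod.mk.injEq, true_and, and_true]; omega)
    (fun a b c d hw ↦ by
      simp only [mem_wordsWith] at hw
      simp only [mem_triangle, Prod.mk.injEq, true_and, and_true]
      omega)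
  have c5 : (wordsWith n fun a b c d ↦ b = d ∧ a + 1 = b ∧ c < b).card =
      (triangle n 2 1).card := card_wordsWith_eq_triangle (fun x ↦ (x.1 - 1, x.1, x.2, x.1))
    (fun w ↦ (w.2.1, w.2.2.1))
    (fun m s _ ↦ by simp only [mem_wordsWith, Prod.mk.injEq, true_and, and_true]; omega)
    (fun a b c d hw ↦ by
      simp only [mem_wordsWith] at hw
      simp only [mem_triangle, Prod.mk.injEq, true_and, and_true]
      omega)
  have c6 : (wordsWith n fun a b c d ↦ a = d ∧ c + 1 = a ∧ b + 2 ≤ a).card =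
      (triangle n 2 2).card := card_wordsWith_eq_triangle (fun x ↦ (x.1, x.2, x.1 - 1, x.1))
    (fun w ↦ (w.1, w.2.1))
    (fun m s _ ↦ by simp only [mem_wordsWith, Prod.mk.injEq, true_and, and_true]; omega)
    (fun a b c d hw ↦ by
      simp only [mem_wordsWith] at hw
      simp only [mem_triangle, Prod.mk.injEq, true_and, and_true]
      omega)
  have c7 : (wordsWith n fun a b c d ↦ a = d ∧ b + 1 = a ∧ c + 2 ≤ a).card =
      (triangle n 2 2).card := card_wordsWith_eq_triangle (fun x ↦ (x.1, x.1 - 1, x.2, x.1))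
    (fun w ↦ (w.1, w.2.2.1))
    (fun m s _ ↦ by simp only [mem_wordsWith, Prod.mk.injEq, true_and, and_true]; omega)
    (fun a b c d hw ↦ by
      simp only [mem_wordsWith] at hw
      simp only [mem_triangle, Prod.mk.injEq, true_and, and_true]
      omega)
  have c8 : (wordsWith n fun a b c d ↦ b = d ∧ c + 1 = b ∧ a + 2 ≤ b).card =
      (triangle n 2 2).card := card_wordsWith_eq_triangle (fun x ↦ (x.2, x.1, x.1 - 1, x.1))
    (fun w ↦ (w.2.1, w.1))
    (fun m s _ ↦ by simp only [mem_wordsWith, Prod.mk.injEq, true_and, and_true]; omega)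
    (fun a b c d hw ↦ by
      simp only [mem_wordsWith] at hw
      simp only [mem_triangle, Prod.mk.injEq, true_and, and_true]
      omega)
  have c9 : (wordsWith n fun a b c d ↦ c + 1 = a ∧ b + d = a).card =
      (triangle n 2 2).card := card_wordsWith_eq_triangle (fun x ↦ (x.1, x.2, x.1 - 1, x.1 - x.2))
    (fun w ↦ (w.1, w.2.1))
    (fun m s _ ↦ by simp only [mem_wordsWith, Prod.mk.injEq, true_and, and_true]; omega)
    (fun a b c d hw ↦ by
      simp only [mem_wordsWith] at hw
      simp only [mem_triangle, Prod.mk.injEq, true_and, and_true]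
      omega)
  have c10 : (wordsWith n fun a b c d ↦ d + 1 = b ∧ a + c = b).card =
      (triangle n 2 2).card := card_wordsWith_eq_triangle (fun x ↦ (x.2, x.1, x.1 - x.2, x.1 - 1))
    (fun w ↦ (w.2.1, w.1))
    (fun m s _ ↦ by simp only [mem_wordsWith, Prod.mk.injEq, true_and, and_true]; omega)
    (fun a b c d hw ↦ by
      simp only [mem_wordsWith] at hw
      simp only [mem_triangle, Prod.mk.injEq, true_and, and_true]
      omega)
  have c11 : (wordsWith n fun a b c d ↦ a + 1 = c ∧ b + d = c).card =
      (triangle n 2 2).card := card_wordsWith_eq_triangle (fun x ↦ (x.1 - 1, x.2, x.1, x.1 - x.2))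
    (fun w ↦ (w.2.2.1, w.2.1))
    (fun m s _ ↦ by simp only [mem_wordsWith, Prod.mk.injEq, true_and, and_true]; omega)
    (fun a b c d hw ↦ by
      simp only [mem_wordsWith] at hw
      simp only [mem_triangle, Prod.mk.injEq, true_and, and_true]
      omega)
  have c12 : (wordsWith n fun a b c d ↦ a = d ∧ c = b + 1 ∧ b + 3 ≤ a).card =
      (triangle n 2 3).card := card_wordsWith_eq_triangle (fun x ↦ (x.1, x.2, x.2 + 1, x.1))
    (fun w ↦ (w.1, w.2.1))
    (fun m s _ ↦ by simp only [mem_wordsWith, Prod.mk.injEq, true_and, and_true]; omega)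
    (fun a b c d hw ↦ by
      simp only [mem_wordsWith] at hw
      simp only [mem_triangle, Prod.mk.injEq, true_and, and_true]
      omega)
  have c13 : (wordsWith n fun a b c d ↦ a = d ∧ b = c + 1 ∧ c + 3 ≤ a).card =
      (triangle n 2 3).card := card_wordsWith_eq_triangle (fun x ↦ (x.1, x.2 + 1, x.2, x.1))
    (fun w ↦ (w.1, w.2.2.1))
    (fun m s _ ↦ by simp only [mem_wordsWith, Prod.mk.injEq, true_and, and_true]; omega)
    (fun a b c d hw ↦ by
      simp only [mem_wordsWith] at hw
      simp only [mem_triangle, Prod.mk.injEq, true_and, and_true]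
      omega)
  have c14 : (wordsWith n fun a b c d ↦ c + 1 = a ∧ b + d + 1 = a).card =
      (triangle n 2 3).card := card_wordsWith_eq_triangle (fun x ↦ (x.1, x.2, x.1 - 1, x.1 - 1 - x.2))
    (fun w ↦ (w.1, w.2.1))
    (fun m s _ ↦ by simp only [mem_wordsWith, Prod.mk.injEq, true_and, and_true]; omega)
    (fun a b c d hw ↦ by
      simp only [mem_wordsWith] at hw
      simp only [mem_triangle, Prod.mk.injEq, true_and, and_true]
      omega)
  have c15 : (wordsWith n fun a b c d ↦ a = 3 ∧ b = 2 ∧ c = 3 ∧ 4 ≤ d).card =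
      (Icc 4 n).card := card_wordsWith_eq_Icc (fun m ↦ (3, 2, 3, m)) (fun w ↦ w.2.2.2)
    (fun m _ ↦ by simp only [mem_wordsWith, true_and, and_true]; omega)
    (fun a b c d hw ↦ by
      simp only [mem_wordsWith] at hw
      simp only [mem_Icc, Prod.mk.injEq, true_and, and_true]
      omega)
  have c16 : (wordsWith n fun a b c d ↦ a = 3 ∧ b = 2 ∧ d + 1 = c ∧ 4 ≤ c).card =
      (Icc 4 n).card := card_wordsWith_eq_Icc (fun m ↦ (3, 2, m, m - 1)) (fun w ↦ w.2.2.1)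
    (fun m _ ↦ by simp only [mem_wordsWith, true_and, and_true]; omega)
    (fun a b c d hw ↦ by
      simp only [mem_wordsWith] at hw
      simp only [mem_Icc, Prod.mk.injEq, true_and, and_true]
      omega)
  have c17 : (wordsWith n fun a b c d ↦ a + 1 = b ∧ b = d ∧ c = b + 1).card =
      (Icc 4 n).card := card_wordsWith_eq_Icc (fun m ↦ (m - 2, m - 1, m, m - 1)) (fun w ↦ w.2.2.1)
    (fun m _ ↦ by simp only [mem_wordsWith, true_and, and_true]; omega)
    (fun a b c d hw ↦ by
      simp only [mem_wordsWith] at hw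
      simp only [mem_Icc, Prod.mk.injEq, true_and, and_true]
      omega)
  have c18 : (wordsWith n fun a b c d ↦ a + 2 = b ∧ b = d ∧ c = 2).card =
      (Icc 4 n).card := card_wordsWith_eq_Icc (fun m ↦ (m - 2, m, 2, m)) (fun w ↦ w.2.1)
    (fun m _ ↦ by simp only [mem_wordsWith, true_and, and_true]; omega)
    (fun a b c d hw ↦ by
      simp only [mem_wordsWith] at hw
      simp only [mem_Icc, Prod.mk.injEq, true_and, and_true]
      omega)
  have c19 : (wordsWith n fun a b c d ↦ b = a + 1 ∧ c = 2 ∧ d = 3 ∧ 4 ≤ b).card =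
      (Icc 4 n).card := card_wordsWith_eq_Icc (fun m ↦ (m - 1, m, 2, 3)) (fun w ↦ w.2.1)
    (fun m _ ↦ by simp only [mem_wordsWith, true_and, and_true]; omega)
    (fun a b c d hw ↦ by
      simp only [mem_wordsWith] at hw
      simp only [mem_Icc, Prod.mk.injEq, true_and, and_true]
      omega)
  have c20 : (wordsWith n fun a b c d ↦ b = 2 ∧ c = 3 ∧ d = 2 ∧ 5 ≤ a).card =
      (Icc 5 n).card := card_wordsWith_eq_Icc (fun m ↦ (m, 2, 3, 2)) (fun w ↦ w.1)
    (fun m _ ↦ by simp only [mem_wordsWith, true_and, and_true]; omega)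
    (fun a b c d hw ↦ by
      simp only [mem_wordsWith] at hw
      simp only [mem_Icc, Prod.mk.injEq, true_and, and_true]
      omega)
  rw [e]
  rw [card_wordsWith_or (by
    intro a b c d _ _ _ _ h h'
    rcases h' with h' | h' | h' | h' | h' | h' | h' | h' | h' | h' | h' | h' | h' | h' | h' | h' | h' | h' | h' | h' <;> omega)]
  rw [card_wordsWith_or (by
    intro a b c d _ _ _ _ h h'
    rcases h' with h' | h' | h' | h' | h' | h' | h' | h' | h' | h' | h' | h' | h' | h' | h' | h' | h' | h' | h' <;> omega)]
  rw [card_wordsWith_or (by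
    intro a b c d _ _ _ _ h h'
    rcases h' with h' | h' | h' | h' | h' | h' | h' | h' | h' | h' | h' | h' | h' | h' | h' | h' | h' | h' <;> omega)]
  rw [card_wordsWith_or (by
    intro a b c d _ _ _ _ h h'
    rcases h' with h' | h' | h' | h' | h' | h' | h' | h' | h' | h' | h' | h' | h' | h' | h' | h' | h' <;> omega)]
  rw [card_wordsWith_or (by
    intro a b c d _ _ _ _ h h'
    rcases h' with h' | h' | h' | h' | h' | h' | h' | h' | h' | h' | h' | h' | h' | h' | h' | h' <;> omega)]
  rw [card_wordsWith_or (by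
    intro a b c d _ _ _ _ h h'
    rcases h' with h' | h' | h' | h' | h' | h' | h' | h' | h' | h' | h' | h' | h' | h' | h' <;> omega)]
  rw [card_wordsWith_or (by
    intro a b c d _ _ _ _ h h'
    rcases h' with h' | h' | h' | h' | h' | h' | h' | h' | h' | h' | h' | h' | h' | h' <;> omega)]
  rw [card_wordsWith_or (by
    intro a b c d _ _ _ _ h h'
    rcases h' with h' | h' | h' | h' | h' | h' | h' | h' | h' | h' | h' | h' | h' <;> omega)]
  rw [card_wordsWith_or (by
    intro a b c d _ _ _ _ h h'
    rcases h' with h' | h' | h' | h' | h' | h' | h' | h' | h' | h' | h' | h' <;> omega)]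
  rw [card_wordsWith_or (by
    intro a b c d _ _ _ _ h h'
    rcases h' with h' | h' | h' | h' | h' | h' | h' | h' | h' | h' | h' <;> omega)]
  rw [card_wordsWith_or (by
    intro a b c d _ _ _ _ h h'
    rcases h' with h' | h' | h' | h' | h' | h' | h' | h' | h' | h' <;> omega)]
  rw [card_wordsWith_or (by
    intro a b c d _ _ _ _ h h'
    rcases h' with h' | h' | h' | h' | h' | h' | h' | h' | h' <;> omega)]
  rw [card_wordsWith_or (by
    intro a b c d _ _ _ _ h h'
    rcases h' with h' | h' | h' | h' | h' | h' | h' | h' <;> omega)]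
  rw [card_wordsWith_or (by
    intro a b c d _ _ _ _ h h'
    rcases h' with h' | h' | h' | h' | h' | h' | h' <;> omega)]
  rw [card_wordsWith_or (by
    intro a b c d _ _ _ _ h h'
    rcases h' with h' | h' | h' | h' | h' | h' <;> omega)]
  rw [card_wordsWith_or (by
    intro a b c d _ _ _ _ h h'
    rcases h' with h' | h' | h' | h' | h' <;> omega)]
  rw [card_wordsWith_or (by
    intro a b c d _ _ _ _ h h'
    rcases h' with h' | h' | h' | h' <;> omega)]
  rw [card_wordsWith_or (by
    intro a b c d _ _ _ _ h h'
    rcases h' with h' | h' | h' <;> omega)]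
  rw [card_wordsWith_or (by
    intro a b c d _ _ _ _ h h'
    rcases h' with h' | h' <;> omega)]
  rw [card_wordsWith_or (by
    intro a b c d _ _ _ _ h h'
    omega)]
  rw [c0, c1, c2, c3, c4, c5, c6, c7, c8, c9, c10, c11, c12, c13, c14, c15, c16, c17, c18, c19, c20]
  simp only [Nat.card_Icc]
  push_cast [card_tetrahedron (show 2 ≤ n by omega)]
  rw [card_triangle (p := 3) (q := 1) (by omega) (by omega),
    card_triangle (p := 3) (q := 2) (by omega) (by omega),
    card_triangle (p := 2) (q := 1) (by omega) (by omega),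
    card_triangle (p := 2) (q := 2) (by omega) (by omega),
    card_triangle (p := 2) (q := 3) (by omega) (by omega),
    Nat.cast_sub (by omega), Nat.cast_sub (by omega)]
  push_cast
  ring

theorem isReduced_of_reducible {n a b c d : ℕ} (h : (a, b, c, d) ∈ wordsWith n Reducible) :
    IsReduced (a, b, c, d) := by
  rw [mem_wordsWith] at h
  obtain ⟨hw, h⟩ := h
  simp only [IsReduced]
  rcases h with ⟨h₁, h₂, h₃⟩ |
    ⟨h₁, h₂, h₃⟩ |
    ⟨h₁, h₂, h₃, h₄⟩ |
    ⟨h₁, h₂, h₃⟩ |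
    ⟨h₁, h₂, h₃⟩ |
    ⟨h₁, h₂, h₃⟩ |
    ⟨h₁, h₂, h₃⟩ |
    ⟨h₁, h₂⟩ |
    ⟨h₁, h₂⟩ |
    ⟨h₁, h₂⟩ |
    ⟨h₁, h₂, h₃⟩ |
    ⟨h₁, h₂, h₃⟩ |
    ⟨h₁, h₂⟩ |
    ⟨h₁, h₂, h₃, h₄⟩ |
    ⟨h₁, h₂, h₃, h₄⟩ |
    ⟨h₁, h₂, h₃⟩ |
    ⟨h₁, h₂, h₃⟩ |
    ⟨h₁, h₂, h₃, h₄⟩ |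
    ⟨h₁, h₂, h₃, h₄⟩ <;>
    omega

end Pancake

/-! ### Reduced words minus reducible words -/

theorem theoremt (n : ℕ) (hn : 4 ≤ n) :
    (Pancake.numAtDist 4 n : ℚ) =
      (1 / 2 : ℚ) * (2 * (n : ℚ) ^ 4 - 15 * (n : ℚ) ^ 3 + 29 * (n : ℚ) ^ 2 + 6 * (n : ℚ) - 34) := by
  classical
  have h : Pancake.numAtDist 4 n + (Pancake.wordsWith n Pancake.Reducible).card =
      ((Pancake.words n).filter Pancake.IsReduced).card := by
    rw [Pancake.numAtDist_four, ← Finset.card_union_of_disjoint]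
    · congr 1
      ext ⟨a, b, c, d⟩
      rw [Finset.mem_union, Finset.mem_filter, Finset.mem_filter]
      constructor
      · rintro (h | h)
        · exact ⟨h.1, h.2.1⟩
        · exact ⟨Pancake.mem_words.2 (Pancake.mem_wordsWith.1 h).1,
            Pancake.isReduced_of_reducible h⟩
      · rintro ⟨hw, hr⟩
        by_cases h : Pancake.Reducible a b c d
        · exact .inr (Pancake.mem_wordsWith.2 ⟨Pancake.mem_words.1 hw, h⟩)
        · exact .inl ⟨hw, hr, h⟩
    · rw [Finset.disjoint_left]
      rintro ⟨a, b, c, d⟩ h₁ h₂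
      exact (Finset.mem_filter.1 h₁).2.2 (Pancake.mem_wordsWith.1 h₂).2
  have h' : (Pancake.numAtDist 4 n : ℚ) = ((Pancake.words n).filter Pancake.IsReduced).card -
      (Pancake.wordsWith n Pancake.Reducible).card := by
    rw [← h]
    push_cast
    ring
  rw [h', Pancake.card_isReduced (by omega), Pancake.card_reducible hn]
  ring
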